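/- Conventions. A variety over a field $F$ is a reduced separated scheme of finite type over $F$. A cover is a finite dominant morphism $\pi\colon Y\to X$ with $Y$ integral and both $X$ and $Y$ normal; its degree is $[F(Y):F(X)]$, the degree of the extension of function fields. It is a Galois cover with group $G$ if $F(Y)/F(X)$ is a Galois extension with Galois group isomorphic to $G$. A set $A\subseteq X(F)$ of rational points is thin if it is contained in a finite union of sets of the form (1) $\pi(Y(F))$ with $\pi\colon Y\to X$ a cover of degree at least $2$, or (2) $W(F)$ with $W\subsetneq X$ a proper Zariski-closed subset. A transcendental field extension $L/k$ of a field $k$ of characteristic $0$ is regular if $k$ is algebraically closed in $L$. Proposition. Let $k$ be a field of characteristic $0$, let $K=k(V)$ be a finitely generated transcendental regular extension of $k$, and let $\bar k(V)=\bar k K$ be the compositum of $K$ with the algebraic closure $\bar k$ of $k$ inside an algebraic closure of $K$. Let $\phi\colon Y\to X$ be a Galois cover with group $G$ of geometrically integral $K$-varieties. Let $S\subseteq X(K)$ be a subset whose natural image in $X_{\bar k(V)}(\bar k(V))$ is a non-thin set of points of the base-changed variety $X_{\bar k(V)}$. Then the set of those $x\in S$ for which the scheme-theoretic fibre $\phi^{-1}(x)$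 is integral, its function field $L$ is a regular extension of $k$, and $L/K$ is Galois with $\operatorname{Gal}(L/K)\simeq G$, is Zariski-dense in $X$. -/

import Mathlib

open CategoryTheory CategoryTheory.Limits AlgebraicGeometry

universe u

noncomputable section

namespace ThinSets

/-! ### Field extensions -/

/-- The extension given by a homomorphism of fields `f : A → B` is Galois with Galois group
isomorphic to `G`. -/
def IsGaloisWithGroup {A B : Type*} [Field A] [Field B] (f : A →+* B)
    (G : Type*) [Group G] : Prop :=
  letI : Algebra A B := f.toAlgebra
  IsGalois A B ∧ Nonempty ((B ≃ₐ[A] B) ≃* G)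

/-- `A` is algebraically closed in `B` along `f : A → B`. In characteristic zero this says that
the extension is regular. -/
def IsRegularExtension {A B : Type*} [Field A] [Field B] (f : A →+* B) : Prop :=
  letI : Algebra A B := f.toAlgebra
  ∀ b : B, IsAlgebraic A b → b ∈ f.range

/-- The compositum `k̄ K` inside an algebraic closure of `K`, where `k̄` is the algebraic closure
of `k` in there. If `K = k(V)` is the function field of a variety `V` over `k`, this is the field
`k̄(V)`. -/
abbrev geometricField (k K : Type u) [Field k] [Field K] [Algebra k K] :
    IntermediateField K (AlgebraicClosure K) :=
  IntermediateField.adjoin K {a : AlgebraicClosure K | IsAlgebraic k a}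

/-! ### Varieties and covers -/

/-- A variety over a field `K`: a reduced, separated scheme of finite type over `K`. -/
structure IsVariety {K : Type u} [Field K] {X : Scheme.{u}} (p : X ⟶ Spec (.of K)) : Prop where
  isReduced : IsReduced X
  isSeparated : IsSeparated p
  locallyOfFiniteType : LocallyOfFiniteType p
  quasiCompact : QuasiCompact p

/-- A scheme is normal if all its local rings are integrally closed domains. -/
def IsNormalScheme (X : Scheme.{u}) : Prop :=
  ∀ x : X, IsDomain (X.presheaf.stalk x) ∧ IsIntegrallyClosed (X.presheaf.stalk x)

/-- A cover `π : Y → X`: a finite dominant morphism, where `Y` is integral and both `X` and `Y`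
are normal. -/
structure IsCover {X Y : Scheme.{u}} (π : Y ⟶ X) : Prop where
  isFinite : IsFinite π
  isDominant : IsDominant π
  isIntegral_source : IsIntegral Y
  isNormal_source : IsNormalScheme Y
  isNormal_target : IsNormalScheme X

lemma map_genericPoint_specializes {X Y : Scheme.{u}} [IsIntegral X] [IsIntegral Y]
    (f : Y ⟶ X) [IsDominant f] : f (genericPoint Y) ⤳ genericPoint X := by
  have h := (genericPoint_spec Y).image f.continuous
  rw [Set.image_univ, f.denseRange.closure_range] at h
  exact h.specializes trivial

/-- The homomorphism of function fields `K(X) → K(Y)` induced by a dominant morphism `Y → X` of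
integral schemes. -/
def functionFieldMap {X Y : Scheme.{u}} [IsIntegral X] [IsIntegral Y]
    (f : Y ⟶ X) [IsDominant f] : X.functionField →+* Y.functionField :=
  (X.presheaf.stalkSpecializes (map_genericPoint_specializes f) ≫
    f.stalkMap (genericPoint Y)).hom

lemma IsCover.isIntegral_target {X Y : Scheme.{u}} {π : Y ⟶ X} (h : IsCover π) :
    IsIntegral X := by
  have := h.isDominant
  have := h.isIntegral_source
  have : ∀ x : X, _root_.IsReduced (X.presheaf.stalk x) := fun x ↦ by
    have := (h.isNormal_target x).1
    infer_instance
  have : IsReduced X := isReduced_of_isReduced_stalk X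
  have : IrreducibleSpace X := by
    have h1 : IsIrreducible (Set.range π) := by
      rw [← Set.image_univ]
      exact (IrreducibleSpace.isIrreducible_univ Y).image _ π.continuous.continuousOn
    have h2 := h1.closure
    rw [π.denseRange.closure_range] at h2
    exact irreducibleSpace_def _ |>.2 h2
  exact isIntegral_of_irreducibleSpace_of_isReduced X

/-- The map of function fields of a cover. -/
def IsCover.fieldMap {X Y : Scheme.{u}} {π : Y ⟶ X} (h : IsCover π) :
    haveI := h.isIntegral_target
    haveI := h.isIntegral_source
    X.functionField →+* Y.functionField :=
  haveI := h.isIntegral_target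
  haveI := h.isIntegral_source
  haveI := h.isDominant
  functionFieldMap π

/-- The degree of a cover `Y → X`, i.e. the degree of the field extension `K(Y) / K(X)`. -/
def IsCover.degree {X Y : Scheme.{u}} {π : Y ⟶ X} (h : IsCover π) : ℕ :=
  haveI := h.isIntegral_target
  haveI := h.isIntegral_source
  letI : Algebra X.functionField Y.functionField := h.fieldMap.toAlgebra
  Module.finrank X.functionField Y.functionField

/-- A Galois cover with group `G`: a cover `Y → X` such that `K(Y) / K(X)` is a Galois extension
with group `G`. -/
def IsGaloisCover {X Y : Scheme.{u}} (π : Y ⟶ X) (G : Type*) [Group G] : Prop :=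
  ∃ h : IsCover π,
    haveI := h.isIntegral_target
    haveI := h.isIntegral_source
    IsGaloisWithGroup h.fieldMap G

/-! ### Rational points -/

/-- For `S = Spec K` this is the set `X(K)` of rational points of the `K`-scheme `p : X → S`. -/
@[ext]
structure RatPoint {X S : Scheme.{u}} (p : X ⟶ S) : Type u where
  hom : S ⟶ X
  w : hom ≫ p = 𝟙 S

/-- The natural map `X(S) → X_T(T)`, where `X_T` is the base change of `X → S` along `T → S`. -/
def RatPoint.baseChange {X S T : Scheme.{u}} {p : X ⟶ S} (x : RatPoint p) (g : T ⟶ S) :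
    RatPoint (pullback.snd p g) :=
  ⟨pullback.lift (g ≫ x.hom) (𝟙 T)
    (by rw [Category.assoc, x.w, Category.comp_id, Category.id_comp]),
    pullback.lift_snd _ _ _⟩

/-- The rational points lying on a subset `W` of `X`. -/
def pointsOn {X S : Scheme.{u}} (p : X ⟶ S) (W : Set X) : Set (RatPoint p) :=
  {x | Set.range x.hom ⊆ W}

/-- The image on rational points of a morphism `π : Y → X` over `S`, i.e. `π(Y(K))` for
`S = Spec K`. -/
def imagePoints {X Y S : Scheme.{u}} (p : X ⟶ S) (π : Y ⟶ X) : Set (RatPoint p) :=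
  {x | ∃ y : RatPoint (π ≫ p), y.hom ≫ π = x.hom}

/-- A set of rational points is Zariski-dense if the underlying points of `X` form a dense set. -/
def IsZariskiDense {X S : Scheme.{u}} {p : X ⟶ S} (A : Set (RatPoint p)) : Prop :=
  Dense (⋃ x ∈ A, Set.range x.hom)

/-- A set of rational points of `p : X → Spec K` is thin if it is contained in a finite union of
sets of the form `π(Y(K))` for a cover `π : Y → X` of degree at least two, and `W(K)` for a proper
Zariski-closed subset `W` of `X`. -/
def IsThin {X S : Scheme.{u}} {p : X ⟶ S} (A : Set (RatPoint p)) : Prop :=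
  ∃ C : Set (Set (RatPoint p)), C.Finite ∧
    (∀ B ∈ C,
      (∃ (Y : Scheme.{u}) (π : Y ⟶ X) (h : IsCover π), 2 ≤ h.degree ∧ B = imagePoints p π) ∨
      (∃ W : Set X, IsClosed W ∧ W ≠ Set.univ ∧ B = pointsOn p W)) ∧
    A ⊆ ⋃₀ C

/-! ### Fibres -/

/-- The inclusion of the ground field `K` into the function field of an integral `K`-scheme. -/
def groundFieldMap {K : Type u} [Field K] {Z : Scheme.{u}} [IsIntegral Z]
    (q : Z ⟶ Spec (.of K)) : K →+* Z.functionField :=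
  ((Scheme.ΓSpecIso (.of K)).inv ≫ q.appTop ≫
    Z.presheaf.germ ⊤ (genericPoint Z) trivial).hom

end ThinSets

end

/-! Let E = k̄K be `geometricField k K`. Over some nonempty affine open U of X the cover has
coordinate ring Γ(X, U)[T]/(f) with f monic and separable (`IsCover.exists_isSimpleEtale`). The
fibre over a point x of U(K) is then Spec K[T]/(f_x), where f_x is f with its coefficients evaluated
at x. Everything depends on whether f_x is irreducible over E, and not merely over K.

If it is, the fibre is the spectrum of a field L of degree deg f over K. The decomposition group of
the corresponding prime surjects onto Gal(L/K), and comparing orders with deg f makes it the whole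
group, isomorphic to Gal(L/K) (`isGalois_of_irreducible_map`). Moreover L embeds in the field
E[T]/(f_x); an element of L algebraic over k lands in E, hence lies in K by comparing coefficients
of powers of T, hence in k because K/k is regular (`isRegularExtension_of_irreducible_map`).

If it is not, x_E lies in a fixed thin set. Geometric integrality makes X_E and Y_E integral, and
X_E is normal because E/K is algebraic of characteristic zero. So f stays irreducible over the
function field F of X_E, and F[T]/(f) is Galois over F. Were the decomposition group D of a prime
above x_E the whole group, all roots of f_x would be roots of one irreducible factor. Hence D is
proper and its fixed field M is larger than F. The residue extension of the decomposition ring is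
trivial, so x_E lifts to a rational point of the normalization of X_E in M, a cover of degree at
least 2. There are only finitely many such M (`isThin_setOf_not_irreducible`).

If the good points missed a nonempty open O, the image of S would lie in the union of this thin set
and the rational points lying outside O ∩ U, so it would be thin. -/

noncomputable section

namespace ThinSets

section

open Polynomial
open scoped Pointwise

/-! ### Specialization of Galois extensions -/

/-- Every prime ideal is the kernel of a homomorphism to a field. -/
lemma exists_ringHom_field_eq_zero_iff {B : Type u} [CommRing B] (Q : Ideal B) [Q.IsPrime] :
    ∃ (κ : Type u) (_ : Field κ) (π : B →+* κ), ∀ x, π x = 0 ↔ x ∈ Q :=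
  ⟨Q.ResidueField, inferInstance, algebraMap B Q.ResidueField, fun _ ↦
    Ideal.algebraMap_residueField_eq_zero⟩

section Decomposition

variable {R B G E : Type*} [CommRing R] [CommRing B] [Algebra R B] [Group G] [Finite G]
  [MulSemiringAction G B] [Algebra.IsInvariant R B G] [SMulCommClass G R B] [Field E]

/-- The residue field of the decomposition ring is trivial. -/
lemma exists_sub_mem_of_fixed_by_stabilizer [CharZero E] (s : R →+* E)
    (hs : Function.Surjective s) (Q : Ideal B) [Q.IsPrime]
    (hQ : Q.comap (algebraMap R B) = RingHom.ker s) (x : B)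
    (hx : ∀ g ∈ MulAction.stabilizer G Q, g • x = x) :
    ∃ r : R, x - algebraMap R B r ∈ Q := by
  have hint : Algebra.IsIntegral R B := Algebra.IsInvariant.isIntegral R B G
  set P := RingHom.ker s with hP
  have hPm : P.IsMaximal := RingHom.ker_isMaximal_of_surjective s hs
  have hlies : Q.LiesOver P := ⟨hQ.symm⟩
  have hQm : Q.IsMaximal := Ideal.isMaximal_of_isIntegral_of_isMaximal_comap Q (hQ ▸ hPm)
  let := Ideal.Quotient.field P
  let := Ideal.Quotient.field Q
  have : CharZero (R ⧸ P) :=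
    (RingHom.quotientKerEquivOfSurjective hs).toRingHom.charZero
  have := Ideal.Quotient.normal G P Q
  have : Algebra.IsAlgebraic (R ⧸ P) (B ⧸ Q) := inferInstance
  -- Normality comes from the group action, separability from characteristic zero. The stabilizer of
  -- Q surjects onto this Galois group, so the class of x is fixed by all of it.
  have : IsGalois (R ⧸ P) (B ⧸ Q) := {}
  have := Ideal.Quotient.finite_of_isInvariant G P Q
  have : algebraMap B (B ⧸ Q) x ∈ (⊥ : IntermediateField (R ⧸ P) (B ⧸ Q)) := by
    rw [IsGalois.mem_bot_iff_fixed]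
    intro f
    obtain ⟨g, rfl⟩ := Ideal.Quotient.stabilizerHom_surjective G P Q f
    change Ideal.Quotient.mk Q (g.1 • x) = Ideal.Quotient.mk Q x
    rw [hx g.1 g.2]
  rw [IntermediateField.mem_bot] at this
  obtain ⟨r, hr⟩ := this
  obtain ⟨r, rfl⟩ := Ideal.Quotient.mk_surjective r
  exact ⟨r, (Ideal.Quotient.eq (I := Q)).mp hr.symm⟩

/-- If the decomposition group is everything, a separable specialization of a polynomial
dividing the characteristic polynomial of `b` and vanishing at `b` is irreducible. -/
lemma irreducible_map_of_stabilizer_eq_top [IsDomain B] (s : R →+* E)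
    (hs : Function.Surjective s) (Q : Ideal B) [Q.IsPrime]
    (hQ : Q.comap (algebraMap R B) = RingHom.ker s)
    (htop : MulAction.stabilizer G Q = ⊤) (b : B) (f : R[X]) (hf : f.Monic)
    (hfb : aeval b f = 0) (hdvd : ∀ p : R[X], aeval b p = 0 → f ∣ p)
    (hsep : (f.map s).Separable) : Irreducible (f.map s) := by
  classical
  cases nonempty_fintype G
  obtain ⟨κ, _, π, hπ⟩ := exists_ringHom_field_eq_zero_iff Q
  obtain ⟨ι, hι⟩ : ∃ ι : E →+* κ, ι.comp s = π.comp (algebraMap R B) :=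
    ⟨RingHom.liftOfSurjective s hs ⟨π.comp (algebraMap R B), fun r hr ↦ by
      rw [RingHom.mem_ker, RingHom.comp_apply, hπ]
      rw [← hQ] at hr
      exact hr⟩, RingHom.liftOfRightInverse_comp ..⟩
  let : Algebra E κ := ι.toAlgebra
  have heval (p : R[X]) (c : B) : aeval (π c) (p.map s) = π (aeval c p) := by
    rw [aeval_def, eval₂_map, aeval_def, hom_eval₂]
    exact congrArg (fun h ↦ eval₂ h (π c) p) hι
  have hint : IsIntegral E (π b) := ⟨f.map s, hf.map s, by
    rw [← aeval_def, heval, hfb, map_zero]⟩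
  -- It suffices that f.map s divides m. Over κ every root of f.map s has the form π (g • b), since
  -- f divides the characteristic polynomial of b. Each of these is a root of m because g preserves
  -- Q, and separability removes any concern about multiplicities.
  set m := minpoly E (π b) with hm
  have hmf : m ∣ f.map s := minpoly.dvd _ _ (by rw [heval, hfb, map_zero])
  obtain ⟨mt, hmt⟩ := Polynomial.map_surjective s hs m
  have hroot (g : G) : aeval (π (g • b)) m = 0 := by
    rw [← hmt, heval, hπ]
    have h1 : aeval b mt ∈ Q := by
      rw [← hπ, ← heval, hmt, hm, minpoly.aeval]
    have h2 : aeval (g • b) mt = g • aeval b mt := by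
      have := Polynomial.aeval_algHom_apply (MulSemiringAction.toAlgHom R B g) b mt
      exact this
    have h3 : g ∈ MulAction.stabilizer G Q := htop ▸ Subgroup.mem_top g
    rw [h2, ← MulAction.mem_stabilizer_iff.mp h3]
    exact Ideal.smul_mem_pointwise_smul g _ _ h1
  obtain ⟨p, hp⟩ := Algebra.IsInvariant.charpoly_mem_lifts R B G b
  have hfp : f ∣ p := hdvd p (by
    rw [aeval_def, ← Polynomial.eval_map, ← coe_mapRingHom, hp, MulSemiringAction.eval_charpoly])
  have hprod : (p.map s).map ι = ∏ g : G, (X - C (π (g • b))) := by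
    rw [Polynomial.map_map, hι, ← Polynomial.map_map, ← coe_mapRingHom (algebraMap R B), hp,
      MulSemiringAction.charpoly_eq, Polynomial.map_prod]
    simp
  have hpsplit : ((p.map s).map ι).Splits := by
    rw [hprod]
    exact .prod fun g _ ↦ .X_sub_C _
  have hp0 : (p.map s).map ι ≠ 0 := by
    rw [hprod]
    exact (monic_prod_of_monic _ _ fun _ _ ↦ monic_X_sub_C _).ne_zero
  have hfpm : (f.map s).map ι ∣ (p.map s).map ι :=
    Polynomial.map_dvd ι (Polynomial.map_dvd s hfp)
  have hfsplit : ((f.map s).map ι).Splits := hpsplit.of_dvd hp0 hfpm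
  have hfm : (f.map s).map ι ∣ m.map ι := by
    have hm0 : m.map ι ≠ 0 := ((minpoly.monic hint).map ι).ne_zero
    have hf0 : (f.map s).map ι ≠ 0 := ((hf.map s).map ι).ne_zero
    rw [hfsplit.dvd_iff_roots_le_roots hf0 hm0,
      Multiset.le_iff_subset (nodup_roots (hsep.map))]
    intro z hz
    have hz' := Multiset.mem_of_le (roots.le_of_dvd hp0 hfpm) hz
    rw [mem_roots hp0, hprod, IsRoot.def, eval_prod, Finset.prod_eq_zero_iff] at hz'
    obtain ⟨g, -, hg⟩ := hz'
    rw [eval_sub, eval_X, eval_C, sub_eq_zero] at hg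
    rw [mem_roots hm0, IsRoot.def, Polynomial.eval_map, hg]
    exact hroot g
  have : Associated m (f.map s) :=
    associated_of_dvd_dvd hmf ((map_dvd_map' ι).mp hfm)
  exact this.irreducible (minpoly.irreducible hint)

end Decomposition

/-- Specializations of the minimal polynomial of a Galois extension that do not lift to any
intermediate extension are irreducible. -/
lemma irreducible_map_of_forall_intermediateField {R F L E : Type*} [CommRing R] [IsDomain R]
    [IsIntegrallyClosed R] [Field F] [Field L] [Algebra R F] [IsFractionRing R F] [Algebra F L]
    [Algebra R L] [IsScalarTower R F L] [FiniteDimensional F L] [IsGalois F L] [Field E]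
    [CharZero E] (s : R →+* E) (hs : Function.Surjective s) (b : L) (hb : IsIntegral R b)
    (hsep : ((minpoly R b).map s).Separable)
    (hM : ∀ M : IntermediateField F L, M ≠ ⊥ →
      ¬ ∃ t : integralClosure R M →+* E, t.comp (algebraMap R (integralClosure R M)) = s) :
    Irreducible ((minpoly R b).map s) := by
  classical
  let B := integralClosure R L
  let := IsIntegralClosure.MulSemiringAction R F L B
  have : IsFractionRing B L := IsIntegralClosure.isFractionRing_of_finite_extension R F L B
  have := Algebra.isInvariant_of_isGalois R F L B
  have : FaithfulSMul R L := by
    rw [faithfulSMul_iff_algebraMap_injective, IsScalarTower.algebraMap_eq R F L]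
    exact (algebraMap F L).injective.comp (IsFractionRing.injective R F)
  have : (RingHom.ker s).IsPrime := RingHom.ker_isPrime s
  have : SMulCommClass (L ≃ₐ[F] L) R B := ⟨fun g r x ↦ by
    change galRestrict R F L B g (r • x) = r • galRestrict R F L B g x
    exact map_smul _ _ _⟩
  have hval (g : L ≃ₐ[F] L) (x : B) : ((g • x : B) : L) = g (x : L) :=
    algebraMap_galRestrict_apply R g x
  have hinj : Function.Injective (algebraMap R B) := FaithfulSMul.algebraMap_injective R B
  obtain ⟨Q, -, hQp, hQ⟩ := Ideal.exists_ideal_over_prime_of_isIntegral (RingHom.ker s) (⊥ : Ideal B)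
    (by rw [← RingHom.ker_eq_comap_bot, (RingHom.injective_iff_ker_eq_bot _).mp hinj]
        exact bot_le)
  -- Otherwise its fixed field M is nontrivial by the Galois correspondence, and s extends to the
  -- integral closure of R in M, against `hM`. The extension sends x to s r for any r in R congruent
  -- to x modulo Q; this is well defined because Q lies over the kernel of s.
  have htop : MulAction.stabilizer (L ≃ₐ[F] L) Q = ⊤ := by
    by_contra hne
    let D := MulAction.stabilizer (L ≃ₐ[F] L) Q
    let M := IntermediateField.fixedField D
    refine hM M ?_ ?_
    · intro h
      apply hne
      have := IntermediateField.fixingSubgroup_fixedField D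
      refine this.symm.trans ?_
      change M.fixingSubgroup = ⊤
      rw [h, IntermediateField.fixingSubgroup_bot]
    · let j : integralClosure R M →ₐ[R] B :=
        ((M.val.restrictScalars R).comp (integralClosure R M).val).codRestrict _ fun x ↦
          x.2.map (M.val.restrictScalars R)
      have hj (x) : ∃ e : R, j x - algebraMap R B e ∈ Q := by
        refine exists_sub_mem_of_fixed_by_stabilizer (G := L ≃ₐ[F] L) s hs Q hQ _ fun g hg ↦ ?_
        apply Subtype.ext
        rw [hval]
        exact (IntermediateField.mem_fixedField_iff D _).mp x.1.2 g hg
      have hmem (r : R) : algebraMap R B r ∈ Q ↔ s r = 0 := by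
        rw [← Ideal.mem_comap, hQ, RingHom.mem_ker]
      have hS : ∀ x : integralClosure R M, ∃ e : E, ∀ r : R, j x - algebraMap R B r ∈ Q → s r = e := by
        intro x
        obtain ⟨e, he⟩ := hj x
        refine ⟨s e, fun r hr ↦ ?_⟩
        rw [← sub_eq_zero, ← map_sub, ← hmem, map_sub]
        have := Q.sub_mem he hr
        simpa using this
      choose t ht using hS
      refine ⟨⟨⟨⟨t, ?_⟩, ?_⟩, ?_, ?_⟩, ?_⟩
      · rw [← ht 1 1 (by simp), map_one]
      · intro x y
        obtain ⟨e, he⟩ := hj x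
        obtain ⟨e', he'⟩ := hj y
        simp only
        rw [← ht x e he, ← ht y e' he', ← map_mul]
        symm
        apply ht
        rw [map_mul, map_mul]
        have : j x * j y - algebraMap R B e * algebraMap R B e' =
          (j x - algebraMap R B e) * j y + algebraMap R B e * (j y - algebraMap R B e') := by ring
        rw [this]
        exact Q.add_mem (Q.mul_mem_right _ he) (Q.mul_mem_left _ he')
      · simp only
        rw [← ht 0 0 (by simp), map_zero]
      · intro x y
        obtain ⟨e, he⟩ := hj x
        obtain ⟨e', he'⟩ := hj y
        simp only
        rw [← ht x e he, ← ht y e' he', ← map_add]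
        symm
        apply ht
        rw [map_add, map_add, add_sub_add_comm]
        exact Q.add_mem he he'
      · ext r
        exact (ht _ r (by rw [j.commutes, sub_self]; exact Q.zero_mem)).symm
  refine irreducible_map_of_stabilizer_eq_top (G := L ≃ₐ[F] L) s hs Q hQ htop ⟨b, hb⟩ _
    (minpoly.monic hb) (Subtype.ext ?_) (fun p hp ↦ ?_) hsep
  · have := Polynomial.aeval_algHom_apply (integralClosure R L).val ⟨b, hb⟩ (minpoly R b)
    simpa using this.symm
  · refine minpoly.isIntegrallyClosed_dvd hb ?_
    have := Polynomial.aeval_algHom_apply (integralClosure R L).val ⟨b, hb⟩ p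
    simpa [hp] using this

end

/-! ### Galois group and regularity of an irreducible specialization -/

section

open Polynomial
open scoped Pointwise

/-- A field is a fraction field of any ring isomorphic to it. -/
lemma isFractionRing_of_bijective {R K : Type*} [CommRing R] [Field K] [Algebra R K]
    (h : Function.Bijective (algebraMap R K)) : IsFractionRing R K := by
  have hu (r : R) (hr : r ∈ nonZeroDivisors R) : algebraMap R K r ≠ 0 := by
    have := (RingEquiv.ofBijective _ h).toMulEquiv.isField (Field.toIsField K)
    have := this.nontrivial
    rw [Ne, map_eq_zero_iff _ h.1]
    exact nonZeroDivisors.ne_zero hr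
  exact ⟨⟨fun r ↦ isUnit_iff_ne_zero.mpr (hu r r.2), fun z ↦ by
    obtain ⟨r, hr⟩ := h.2 z
    exact ⟨(r, 1), by simp [hr]⟩, fun {x y} hxy ↦ ⟨1, by rw [h.1 hxy]⟩⟩⟩

lemma finrank_eq_natDegree_of_adjoin_eq_top {F L : Type*} [Field F] [Field L] [Algebra F L]
    [FiniteDimensional F L] {x : L} (h : IntermediateField.adjoin F {x} = ⊤) :
    Module.finrank F L = (minpoly F x).natDegree := by
  rw [← IntermediateField.adjoin.finrank (Algebra.IsIntegral.isIntegral x), h,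
    IntermediateField.finrank_top']

/-- An irreducible specialization of a Galois extension is Galois, with the same group. -/
lemma isGalois_of_irreducible_map {R F L K A : Type*} [CommRing R] [IsDomain R]
    [IsIntegrallyClosed R] [Field F] [Field L] [Algebra R F] [IsFractionRing R F] [Algebra F L]
    [Algebra R L] [IsScalarTower R F L] [FiniteDimensional F L] [IsGalois F L]
    [Field K] [CharZero K] [Field A] [Algebra K A]
    (s : R →+* K) (hs : Function.Surjective s) (b : integralClosure R L)
    (hgen : IntermediateField.adjoin F {(b : L)} = ⊤)
    (hirr : Irreducible ((minpoly R (b : L)).map s))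
    (θ : integralClosure R L →+* A)
    (hθ : θ.comp (algebraMap R (integralClosure R L)) = (algebraMap K A).comp s)
    (hA : Algebra.adjoin K {θ b} = ⊤) :
    IsGalois K A ∧ Nonempty ((A ≃ₐ[K] A) ≃* (L ≃ₐ[F] L)) := by
  let B := integralClosure R L
  let := IsIntegralClosure.MulSemiringAction R F L B
  have : IsFractionRing B L := IsIntegralClosure.isFractionRing_of_finite_extension R F L B
  have := Algebra.isInvariant_of_isGalois R F L B
  have : SMulCommClass (L ≃ₐ[F] L) R B := ⟨fun g r x ↦ by
    change galRestrict R F L B g (r • x) = r • galRestrict R F L B g x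
    exact map_smul _ _ _⟩
  have hθ' (r : R) : θ (algebraMap R B r) = algebraMap K A (s r) := congr($hθ r)
  have hθs : Function.Surjective θ := by
    have h1 : ∀ a ∈ Algebra.adjoin K {θ b}, a ∈ θ.range := by
      intro a ha
      induction ha using Algebra.adjoin_induction with
      | mem x hx => exact ⟨b, by rw [Set.mem_singleton_iff.mp hx]⟩
      | algebraMap r =>
        obtain ⟨r, rfl⟩ := hs r
        exact ⟨_, hθ' r⟩
      | add x y _ _ hx hy => exact add_mem hx hy
      | mul x y _ _ hx hy => exact mul_mem hx hy
    intro a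
    exact h1 a (hA ▸ Algebra.mem_top)
  let P := RingHom.ker s
  let Q := RingHom.ker θ
  have : Q.LiesOver P := ⟨by
    ext r
    change s r = 0 ↔ θ (algebraMap R B r) = 0
    rw [hθ' r, map_eq_zero_iff _ (algebraMap K A).injective]⟩
  have : P.IsPrime := RingHom.ker_isPrime s
  have : Q.IsPrime := RingHom.ker_isPrime θ
  let eP := RingHom.quotientKerEquivOfSurjective hs
  let eQ := RingHom.quotientKerEquivOfSurjective hθs
  -- K and A are identified with R ⧸ P and B ⧸ Q, so that the theory of decomposition groups applies
  -- to the extension A/K itself.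
  let : Algebra (R ⧸ P) K := eP.toRingHom.toAlgebra
  let : Algebra (B ⧸ Q) A := eQ.toRingHom.toAlgebra
  let : Algebra (R ⧸ P) A := ((algebraMap K A).comp eP.toRingHom).toAlgebra
  have : IsScalarTower (R ⧸ P) K A := .of_algebraMap_eq fun _ ↦ rfl
  have : IsScalarTower (R ⧸ P) (B ⧸ Q) A := .of_algebraMap_eq fun r ↦ by
    obtain ⟨r, rfl⟩ := Ideal.Quotient.mk_surjective r
    exact (hθ' r).symm
  have : IsFractionRing (R ⧸ P) K := isFractionRing_of_bijective eP.bijective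
  have : IsFractionRing (B ⧸ Q) A := isFractionRing_of_bijective eQ.bijective
  have hbint : IsIntegral R (b : L) := b.2
  have hroot : aeval (θ b) ((minpoly R (b : L)).map s) = 0 := by
    have h0 : aeval b (minpoly R (b : L)) = 0 := Subtype.ext (by
      have := Polynomial.aeval_algHom_apply (integralClosure R L).val b (minpoly R (b : L))
      simpa using this.symm)
    rw [aeval_def, eval₂_map, ← hθ, ← hom_eval₂, ← aeval_def, h0, map_zero]
  have hint : IsIntegral K (θ b) := ⟨_, (minpoly.monic hbint).map s, hroot⟩
  have hmin : minpoly K (θ b) = (minpoly R (b : L)).map s :=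
    (minpoly.eq_of_irreducible_of_monic hirr hroot ((minpoly.monic hbint).map s)).symm
  have hgenA : IntermediateField.adjoin K {θ b} = ⊤ := by
    rw [← IntermediateField.toSubalgebra_injective.eq_iff,
      IntermediateField.adjoin_simple_toSubalgebra_of_isAlgebraic hint.isAlgebraic, hA]
    rfl
  have hfin : FiniteDimensional K A := by
    have := IntermediateField.adjoin.finiteDimensional hint
    rw [hgenA] at this
    exact Module.Finite.equiv IntermediateField.topEquiv.toLinearEquiv
  have : Normal K A := Ideal.IsFractionRing.normal (L ≃ₐ[F] L) P Q K A
  have hgal : IsGalois K A := {}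
  refine ⟨hgal, ?_⟩
  -- Both orders are the degree of the same monic polynomial, before and after specialization. As D
  -- surjects onto the second group and is contained in the first, all three orders agree.
  have hcard : Nat.card (L ≃ₐ[F] L) = Nat.card (A ≃ₐ[K] A) := by
    rw [IsGalois.card_aut_eq_finrank, IsGalois.card_aut_eq_finrank,
      finrank_eq_natDegree_of_adjoin_eq_top hgen, finrank_eq_natDegree_of_adjoin_eq_top hgenA,
      hmin, (minpoly.monic hbint).natDegree_map,
      minpoly.isIntegrallyClosed_eq_field_fractions' F hbint, (minpoly.monic hbint).natDegree_map]
  have hsurj := IsFractionRing.stabilizerHom_surjective (L ≃ₐ[F] L) P Q K A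
  let D := MulAction.stabilizer (L ≃ₐ[F] L) Q
  have h1 : Nat.card (A ≃ₐ[K] A) ≤ Nat.card D := Nat.card_le_card_of_surjective _ hsurj
  have h2 : Nat.card D ≤ Nat.card (L ≃ₐ[F] L) := Subgroup.card_le_card_group D
  have htop : D = ⊤ := Subgroup.eq_top_of_le_card D (by omega)
  have hbij : Function.Bijective (IsFractionRing.stabilizerHom (L ≃ₐ[F] L) P Q K A) :=
    hsurj.bijective_of_nat_card_le (by change Nat.card D ≤ _; omega)
  exact ⟨(MulEquiv.ofBijective _ hbij).symm.trans
    ((MulEquiv.subgroupCongr htop).trans Subgroup.topEquiv)⟩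

/-- An extension generated by a root of a polynomial that stays irreducible over `k̄ K` is
regular over `k`. -/
lemma isRegularExtension_of_irreducible_map {k K A : Type u} [Field k] [Field K] [Algebra k K]
    [Field A] [Algebra K A] (hreg : IsRegularExtension (algebraMap k K)) (f : K[X]) (hf : f.Monic)
    (hirr : Irreducible (f.map (algebraMap K (geometricField k K)))) (β : A)
    (hβ : aeval β f = 0) (hA : Algebra.adjoin K {β} = ⊤) :
    IsRegularExtension ((algebraMap K A).comp (algebraMap k K)) := by
  let E := geometricField k K
  intro a ha
  let : Algebra k A := ((algebraMap K A).comp (algebraMap k K)).toAlgebra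
  have : IsScalarTower k K A := .of_algebraMap_eq fun _ ↦ rfl
  have hirrK : Irreducible f := hf.irreducible_of_irreducible_map _ _ hirr
  have hmin : minpoly K β = f := (minpoly.eq_of_irreducible_of_monic hirrK hβ hf).symm
  have hint : IsIntegral K β := ⟨f, hf, hβ⟩
  let pb := PowerBasis.ofAdjoinEqTop hint hA
  have hpb : pb.gen = β := PowerBasis.ofAdjoinEqTop_gen hint hA
  have hpbdim : pb.dim = f.natDegree := by
    rw [← pb.natDegree_minpoly, hpb, hmin]
  have := Fact.mk hirr
  let AE := AdjoinRoot (f.map (algebraMap K E))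
  let ψ : A →ₐ[K] AE := pb.lift (AdjoinRoot.root _) (by
    rw [hpb, hmin, aeval_def, AdjoinRoot.algebraMap_eq', ← eval₂_map]
    exact AdjoinRoot.eval₂_root _)
  have hψ : ψ β = AdjoinRoot.root _ := by
    rw [← hpb]
    exact pb.lift_gen _ _
  have hroot : aeval (ψ a) ((minpoly k a).map (algebraMap k K)) = 0 := by
    rw [aeval_map_algebraMap]
    exact (aeval_algHom_apply (ψ.restrictScalars k) a _).trans (by rw [minpoly.aeval, map_zero])
  set p := minpoly k a with hp
  have hp0 : p ≠ 0 := minpoly.ne_zero ha.isIntegral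
  -- All roots of p in the algebraic closure of K are algebraic over k, and E contains all such
  -- elements by construction. Hence ψ a, a root of p in an extension of E, already lies in E.
  have hsplit : ((p.map (algebraMap k K)).map (algebraMap K E)).Splits := by
    refine IntermediateField.splits_of_splits (IsAlgClosed.splits _) fun x hx ↦ ?_
    refine IntermediateField.subset_adjoin _ _ ⟨p, hp0, ?_⟩
    rw [mem_rootSet, aeval_map_algebraMap] at hx
    exact hx.2
  obtain ⟨e, he⟩ : ψ a ∈ (algebraMap E AE).range := by
    refine hsplit.mem_range_of_isRoot (i := algebraMap E AE) ?_ ?_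
    · exact Polynomial.map_ne_zero (Polynomial.map_ne_zero hp0)
    · rw [aeval_def, IsScalarTower.algebraMap_eq K E AE, ← eval₂_map, ← Polynomial.eval_map] at hroot
      exact hroot
  obtain ⟨h, hdeg, hh⟩ := pb.exists_eq_aeval a
  rw [hpbdim] at hdeg
  rw [hpb] at hh
  have hz : aeval (AdjoinRoot.root (f.map (algebraMap K E)))
      (h.map (algebraMap K E) - C e) = 0 := by
    rw [map_sub, aeval_C, he, hh, ← aeval_algHom_apply, hψ, aeval_map_algebraMap, sub_self]
  have hdvd : f.map (algebraMap K E) ∣ h.map (algebraMap K E) - C e := by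
    rwa [← AdjoinRoot.mk_eq_zero, ← AdjoinRoot.aeval_eq]
  -- A multiple of f of smaller degree vanishes, so h equals the constant e, and a lies in K.
  have hdeg' : (h.map (algebraMap K E) - C e).natDegree < (f.map (algebraMap K E)).natDegree := by
    rw [natDegree_sub_C, natDegree_map, natDegree_map]
    exact hdeg
  have hzero := Polynomial.eq_zero_of_dvd_of_natDegree_lt hdvd hdeg'
  have hC : h = C (h.coeff 0) := by
    rw [sub_eq_zero] at hzero
    apply eq_C_of_natDegree_eq_zero
    rw [← natDegree_map (algebraMap K E), hzero, natDegree_C]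
  rw [hC, aeval_C] at hh
  rw [hh] at ha
  obtain ⟨q, hq0, hq⟩ := (isAlgebraic_algebraMap_iff (algebraMap K A).injective).mp ha
  obtain ⟨c, hc⟩ := hreg (h.coeff 0) ⟨q, hq0, hq⟩
  exact ⟨c, by rw [hh, ← hc]; rfl⟩

/-- The base change of a monogenic extension is monogenic. -/
lemma exists_ringEquiv_adjoinRoot_of_isPushout {R B R' D : CommRingCat.{u}} {i : R ⟶ B}
    {s : R ⟶ R'} {j : B ⟶ D} {t : R' ⟶ D} (h : IsPushout i s j t) (f : R[X]) (b : B)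
    (hb : eval₂ i.hom b f = 0) (hgen : ∀ c : B, ∃ p : R[X], eval₂ i.hom b p = c)
    (hker : ∀ p : R[X], eval₂ i.hom b p = 0 → f ∣ p) :
    ∃ e : D ≃+* AdjoinRoot (f.map s.hom), (∀ r, e (t.hom r) = AdjoinRoot.of _ r) ∧
      e (j.hom b) = AdjoinRoot.root _ := by
  let Q := AdjoinRoot (f.map s.hom)
  let ev : R[X] →+* B := eval₂RingHom i.hom b
  let evQ : R[X] →+* Q := eval₂RingHom ((AdjoinRoot.of (f.map s.hom)).comp s.hom) (AdjoinRoot.root _)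
  have hevQ : evQ f = 0 := by
    change eval₂ ((AdjoinRoot.of (f.map s.hom)).comp s.hom) (AdjoinRoot.root _) f = 0
    rw [← eval₂_map]
    exact AdjoinRoot.eval₂_root _
  obtain ⟨u, hu⟩ : ∃ u : B →+* Q, u.comp ev = evQ :=
    ⟨RingHom.liftOfSurjective ev hgen ⟨evQ, fun p hp ↦ by
      obtain ⟨q, rfl⟩ := hker p hp
      rw [RingHom.mem_ker, map_mul, hevQ, zero_mul]⟩, RingHom.liftOfRightInverse_comp ..⟩
  have hui : u.comp i.hom = (AdjoinRoot.of (f.map s.hom)).comp s.hom := by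
    ext r
    simpa [ev, evQ] using congr($hu (C r))
  have hub : u b = AdjoinRoot.root _ := by
    simpa [ev, evQ] using congr($hu X)
  let v : D ⟶ CommRingCat.of Q := h.desc (CommRingCat.ofHom u) (CommRingCat.ofHom (AdjoinRoot.of _))
    (by ext1; exact hui)
  have hjv : j ≫ v = CommRingCat.ofHom u := h.inl_desc _ _ _
  have htv : t ≫ v = CommRingCat.ofHom (AdjoinRoot.of (f.map s.hom)) := h.inr_desc _ _ _
  have hw : t.hom.comp s.hom = j.hom.comp i.hom := congr(($h.w).hom).symm
  have hlift : eval₂ t.hom (j.hom b) (f.map s.hom) = 0 := by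
    rw [eval₂_map, hw, ← hom_eval₂, hb, map_zero]
  let w : Q →+* D := AdjoinRoot.lift t.hom (j.hom b) hlift
  have hvw : v ≫ CommRingCat.ofHom w = 𝟙 D := by
    apply h.hom_ext
    · rw [reassoc_of% hjv, Category.comp_id]
      ext c
      obtain ⟨p, rfl⟩ := hgen c
      change w (u (ev p)) = j.hom (eval₂ i.hom b p)
      rw [← RingHom.comp_apply u, hu, hom_eval₂, ← hw]
      change w (eval₂ _ _ p) = _
      rw [hom_eval₂, ← RingHom.comp_assoc]
      congr 1
      · congr 1
        ext r
        exact AdjoinRoot.lift_of hlift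
      · exact AdjoinRoot.lift_root hlift
    · rw [reassoc_of% htv, Category.comp_id]
      ext c
      exact AdjoinRoot.lift_of hlift
  have h1 (r) : v.hom (t.hom r) = AdjoinRoot.of _ r := congr(($htv).hom r)
  have h2 : v.hom (j.hom b) = AdjoinRoot.root _ := congr(($hjv).hom b).trans hub
  refine ⟨RingEquiv.ofRingHom v.hom w ?_ congr(($hvw).hom), h1, h2⟩
  apply AdjoinRoot.ringHom_ext
  · ext r
    change v.hom (w (AdjoinRoot.of _ r)) = _
    rw [AdjoinRoot.lift_of, h1]
    rfl
  · change v.hom (w (AdjoinRoot.root _)) = _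
    rw [AdjoinRoot.lift_root, h2]
    rfl

end

/-! ### Discriminants: normality under base change, and primitive generators -/

section

open Polynomial

/-- Normality is preserved by algebraic extensions of a ground field of characteristic zero, as
long as the result is a domain. -/
lemma isIntegrallyClosed_of_adjoin_eq_top {K R D E : Type*} [Field K] [CharZero K] [CommRing R]
    [IsDomain R] [IsIntegrallyClosed R] [CommRing D] [IsDomain D] [Field E] [Algebra K R]
    [Algebra K D] [Algebra R D] [IsScalarTower K R D] [Algebra K E] [Algebra.IsAlgebraic K E]
    [FaithfulSMul R D] (ι : E →ₐ[K] D) (h : Algebra.adjoin R (Set.range ι) = ⊤) :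
    IsIntegrallyClosed D := by
  classical
  let F := FractionRing R
  let Ω := FractionRing D
  let : Algebra F Ω := FractionRing.liftAlgebra R Ω
  have : IsScalarTower R F Ω := FractionRing.isScalarTower_liftAlgebra R Ω
  have : IsScalarTower K F Ω := .of_algebraMap_eq fun x ↦ by
    rw [IsScalarTower.algebraMap_apply K R F, ← IsScalarTower.algebraMap_apply R F Ω,
      ← IsScalarTower.algebraMap_apply K R Ω]
  have hιint (e : E) : IsIntegral R (ι e) :=
    ((Algebra.IsIntegral.isIntegral (R := K) e).map ι).tower_top
  have hDint : Algebra.IsIntegral R D := by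
    refine ⟨fun d ↦ ?_⟩
    have : d ∈ Algebra.adjoin R (Set.range ι) := h ▸ Algebra.mem_top
    refine Algebra.adjoin_le (S := integralClosure R D) ?_ this
    rintro _ ⟨e, rfl⟩
    exact hιint e
  let ι' : E →ₐ[K] Ω := (IsScalarTower.toAlgHom K D Ω).comp ι
  have hDmem (d : D) : algebraMap D Ω d ∈ IntermediateField.adjoin F (Set.range ι') := by
    have hd : d ∈ Algebra.adjoin R (Set.range ι) := h ▸ Algebra.mem_top
    induction hd using Algebra.adjoin_induction with
    | mem x hx =>
      obtain ⟨e, rfl⟩ := hx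
      exact IntermediateField.subset_adjoin _ _ ⟨e, rfl⟩
    | algebraMap r =>
      rw [← IsScalarTower.algebraMap_apply R D Ω, IsScalarTower.algebraMap_apply R F Ω]
      exact IntermediateField.algebraMap_mem _ _
    | add x y _ _ hx hy => rw [map_add]; exact add_mem hx hy
    | mul x y _ _ hx hy => rw [map_mul]; exact mul_mem hx hy
  rw [isIntegrallyClosed_iff Ω]
  intro z hz
  have hzR : IsIntegral R z := isIntegral_trans (A := D) z hz
  have hzmem : z ∈ IntermediateField.adjoin F (Set.range ι') := by
    obtain ⟨u, v, -, rfl⟩ := IsFractionRing.div_surjective D z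
    exact div_mem (hDmem u) (hDmem v)
  -- E may be infinite over K, but z involves only finitely many of its elements, and these lie in
  -- K(α) for a single α.
  obtain ⟨T, hT, hzT⟩ := IntermediateField.exists_finset_of_mem_adjoin hzmem
  obtain ⟨T', hT'⟩ : ∃ T' : Finset E, T'.image ι' = T := by
    rw [← Set.image_univ, Finset.subset_set_image_iff] at hT
    obtain ⟨T', -, h⟩ := hT
    exact ⟨T', h⟩
  have hfd : FiniteDimensional K (IntermediateField.adjoin K (T' : Set E)) :=
    IntermediateField.finiteDimensional_adjoin fun x _ ↦ Algebra.IsIntegral.isIntegral x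
  obtain ⟨α, hα⟩ := Field.exists_primitive_element K (IntermediateField.adjoin K (T' : Set E))
  have hαint : IsIntegral K (ι' α) := (Algebra.IsIntegral.isIntegral (R := K) (α : E)).map ι'
  have hTα (e : E) (he : e ∈ T') : ∃ q : K[X], aeval (α : E) q = e := by
    have h1 : (⟨e, IntermediateField.subset_adjoin _ _ he⟩ :
      IntermediateField.adjoin K (T' : Set E)) ∈ IntermediateField.adjoin K {α} := by
      rw [hα]; trivial
    rw [← IntermediateField.mem_toSubalgebra,
      IntermediateField.adjoin_simple_toSubalgebra_of_isAlgebraic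
        (Algebra.IsAlgebraic.isAlgebraic α), Algebra.adjoin_singleton_eq_range_aeval] at h1
    obtain ⟨q, hq⟩ := h1
    refine ⟨q, ?_⟩
    have := congrArg (IntermediateField.val _) hq
    change IntermediateField.val _ (aeval α q) = _ at this
    rw [← aeval_algHom_apply] at this
    exact this
  have hle : IntermediateField.adjoin F (T : Set Ω) ≤ IntermediateField.adjoin F {ι' α} := by
    rw [IntermediateField.adjoin_le_iff]
    intro t ht
    rw [← hT', Finset.coe_image] at ht
    obtain ⟨e, he, rfl⟩ := ht
    obtain ⟨q, rfl⟩ := hTα e he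
    rw [← aeval_algHom_apply, ← aeval_map_algebraMap F]
    exact (IntermediateField.algebra_adjoin_le_adjoin F _)
      (aeval_mem_adjoin_singleton F _)
  have hαF : IsIntegral F (ι' α) := hαint.tower_top
  let pb := IntermediateField.adjoin.powerBasis hαF
  have hgen : (pb.gen : Ω) = ι' α := rfl
  have hfdL : FiniteDimensional F (IntermediateField.adjoin F {ι' (α : E)}) :=
    IntermediateField.adjoin.finiteDimensional hαF
  have : CharZero F := charZero_of_injective_algebraMap (algebraMap K F).injective
  have : IsScalarTower K R (IntermediateField.adjoin F {ι' (α : E)}) :=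
    .of_algebraMap_eq fun x ↦ Subtype.ext (IsScalarTower.algebraMap_apply K R Ω x)
  have hpbK : IsIntegral K pb.gen :=
    (isIntegral_algHom_iff ((IntermediateField.val _).restrictScalars K) Subtype.val_injective).mp
      hαint
  have hdint : IsIntegral K (Algebra.discr F pb.basis) := Algebra.discr_isIntegral _ fun i ↦ by
    rw [pb.basis_eq_pow]
    exact hpbK.pow _
  have hd0 : Algebra.discr F pb.basis ≠ 0 := Algebra.discr_not_zero_of_basis F pb.basis
  -- The discriminant of the powers of α is algebraic over the field K, so its inverse is integral
  -- over K and lies in R. Multiplying z by the discriminant gives an element of R[α], hence z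
  -- itself is in R[α].
  obtain ⟨r, hr⟩ := IsIntegrallyClosed.algebraMap_eq_of_integral
    (hdint.inv.tower_top (A := R))
  let z' : IntermediateField.adjoin F {ι' (α : E)} := ⟨z, hle hzT⟩
  have hz'R : IsIntegral R z' :=
    (isIntegral_algHom_iff ((IntermediateField.val _).restrictScalars R) Subtype.val_injective).mp
      hzR
  have hmem := Algebra.discr_mul_isIntegral_mem_adjoin F (R := R) (B := pb) hpbK.tower_top hz'R
  have hmem2 := Subalgebra.smul_mem _ hmem r
  rw [← IsScalarTower.algebraMap_smul F r, hr, smul_smul, inv_mul_cancel₀ hd0, one_smul] at hmem2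
  have : z ∈ Algebra.adjoin R {ι' (α : E)} := by
    have h1 : z ∈ (Algebra.adjoin R {pb.gen}).map ((IntermediateField.val _).restrictScalars R) :=
      ⟨z', hmem2, rfl⟩
    rwa [AlgHom.map_adjoin_singleton] at h1
  have hle2 : Algebra.adjoin R {ι' (α : E)} ≤ (IsScalarTower.toAlgHom R D Ω).range :=
    Algebra.adjoin_le (by rintro _ rfl; exact ⟨ι α, rfl⟩)
  exact hle2 this

/-- A generator of a finite separable extension of fraction fields that generates the integral
closures of all extensions of the base in which a given nonzero element is invertible. -/
lemma exists_primitive_integral {R F L : Type u} [CommRing R] [IsDomain R] [IsIntegrallyClosed R]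
    [Field F] [Field L] [Algebra R F] [IsFractionRing R F] [Algebra F L] [Algebra R L]
    [IsScalarTower R F L] [FiniteDimensional F L] [Algebra.IsSeparable F L] :
    ∃ (b : L) (r : R), r ≠ 0 ∧ IsIntegral R b ∧ IntermediateField.adjoin F {b} = ⊤ ∧
      ∀ (R' : Type u) [CommRing R'] [IsDomain R'] [IsIntegrallyClosed R'] [Algebra R R']
        [Algebra R' F] [IsFractionRing R' F] [Algebra R' L] [IsScalarTower R' F L]
        [IsScalarTower R R' F], IsUnit (algebraMap R R' r) →
        (∀ c : L, IsIntegral R' c → c ∈ Algebra.adjoin R' {b}) ∧ (minpoly R' b).Separable := by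
  obtain ⟨x, hx⟩ := Field.exists_primitive_element F L
  obtain ⟨y, hy0, hy⟩ := IsAlgebraic.exists_integral_multiple
    ((IsFractionRing.isAlgebraic_iff R F L).mpr (Algebra.IsAlgebraic.isAlgebraic x))
  set b := y • x with hb
  have hyF : algebraMap R F y ≠ 0 := by
    rwa [Ne, map_eq_zero_iff _ (IsFractionRing.injective R F)]
  have hbgen : IntermediateField.adjoin F {b} = ⊤ := by
    rw [eq_top_iff, ← hx, IntermediateField.adjoin_simple_le_iff]
    have h1 : (algebraMap R F y)⁻¹ • b ∈ IntermediateField.adjoin F {b} :=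
      IntermediateField.smul_mem _ (IntermediateField.mem_adjoin_simple_self F b)
    have h2 : (algebraMap R F y)⁻¹ • b = x := by
      rw [hb, ← IsScalarTower.algebraMap_smul F y x, smul_smul, inv_mul_cancel₀ hyF, one_smul]
    rwa [h2] at h1
  have hbF : IsIntegral F b := hy.tower_top
  have hsub : Algebra.adjoin F {b} = ⊤ := by
    rw [← IntermediateField.adjoin_simple_toSubalgebra_of_isAlgebraic hbF.isAlgebraic, hbgen]
    rfl
  let pb := PowerBasis.ofAdjoinEqTop hbF hsub
  have hpb : pb.gen = b := PowerBasis.ofAdjoinEqTop_gen hbF hsub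
  have hdint : IsIntegral R (Algebra.discr F pb.basis) := Algebra.discr_isIntegral _ fun i ↦ by
    rw [pb.basis_eq_pow, hpb]
    exact hy.pow _
  have hd0 : Algebra.discr F pb.basis ≠ 0 := Algebra.discr_not_zero_of_basis F pb.basis
  obtain ⟨d, hd⟩ := IsIntegrallyClosed.algebraMap_eq_of_integral hdint
  have hd' : d ≠ 0 := by
    rintro rfl
    exact hd0 (by rw [← hd, map_zero])
  obtain ⟨u, v, huv⟩ : (minpoly F b).Separable := Algebra.IsSeparable.isSeparable F b
  obtain ⟨a₁, ha₁, hu⟩ := IsLocalization.integerNormalization_spec (nonZeroDivisors R) u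
  obtain ⟨a₂, ha₂, hv⟩ := IsLocalization.integerNormalization_spec (nonZeroDivisors R) v
  -- Inverting the discriminant d makes the integral closure generated by b. Inverting a₁ and a₂,
  -- which clear the denominators in the Bézout relation between the minimal polynomial and its
  -- derivative, makes this polynomial separable over the ring and not only over F.
  refine ⟨b, d * (a₁ * a₂), mul_ne_zero hd' (mul_ne_zero (nonZeroDivisors.ne_zero ha₁)
    (nonZeroDivisors.ne_zero ha₂)), hy, hbgen, fun R' _ _ _ _ _ _ _ _ _ hunit ↦ ?_⟩
  rw [map_mul, map_mul, IsUnit.mul_iff, IsUnit.mul_iff] at hunit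
  have : IsScalarTower R R' L := .of_algebraMap_eq fun x ↦ by
    rw [IsScalarTower.algebraMap_apply R' F L, ← IsScalarTower.algebraMap_apply R R' F,
      ← IsScalarTower.algebraMap_apply R F L]
  constructor
  · intro c hc
    have hbR' : IsIntegral R' pb.gen := by rw [hpb]; exact hy.tower_top
    have hmem := Algebra.discr_mul_isIntegral_mem_adjoin F (R := R') (B := pb) hbR' hc
    obtain ⟨w, hw⟩ := hunit.1.exists_left_inv
    have hmem2 := Subalgebra.smul_mem _ hmem w
    rw [← hd, IsScalarTower.algebraMap_apply R R' F, ← IsScalarTower.algebraMap_smul F w, smul_smul,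
      ← map_mul, hw, map_one, one_smul, hpb] at hmem2
    exact hmem2
  · have hbR' : IsIntegral R' b := hy.tower_top
    obtain ⟨w₁, hw₁⟩ := hunit.2.1.exists_left_inv
    obtain ⟨w₂, hw₂⟩ := hunit.2.2.exists_left_inv
    refine ⟨C w₁ * (IsLocalization.integerNormalization (nonZeroDivisors R) u).map (algebraMap R R'),
      C w₂ * (IsLocalization.integerNormalization (nonZeroDivisors R) v).map (algebraMap R R'), ?_⟩
    apply Polynomial.map_injective _ (IsFractionRing.injective R' F)
    have e1 : algebraMap R' F w₁ * algebraMap R F a₁ = 1 := by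
      rw [IsScalarTower.algebraMap_apply R R' F, ← map_mul, hw₁, map_one]
    have e2 : algebraMap R' F w₂ * algebraMap R F a₂ = 1 := by
      rw [IsScalarTower.algebraMap_apply R R' F, ← map_mul, hw₂, map_one]
    rw [Polynomial.map_add, Polynomial.map_mul, Polynomial.map_mul, Polynomial.map_mul,
      Polynomial.map_mul, ← derivative_map, ← minpoly.isIntegrallyClosed_eq_field_fractions' F hbR',
      Polynomial.map_map, Polynomial.map_map, ← IsScalarTower.algebraMap_eq R R' F, hu, hv,
      Polynomial.map_one, map_C, map_C, ← huv,
      ← IsScalarTower.algebraMap_smul F, ← IsScalarTower.algebraMap_smul F a₂,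
      smul_eq_C_mul, smul_eq_C_mul, ← mul_assoc (C _) (C _), ← mul_assoc (C _) (C _),
      ← C_mul, ← C_mul, e1, e2, C_1, one_mul, one_mul]

end

section

/-! ### Normal schemes and function fields -/

/-- Being integrally closed can be checked at maximal ideals, where the localizations are stalks of
X. -/
lemma IsNormalScheme.isIntegrallyClosed {X : Scheme.{u}} [IsIntegral X] (hX : IsNormalScheme X)
    {U : X.Opens} (hU : IsAffineOpen U) [Nonempty U] : IsIntegrallyClosed Γ(X, U) := by
  refine IsIntegrallyClosed.of_localization_maximal fun P _ hP ↦ ?_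
  let y : PrimeSpectrum Γ(X, U) := ⟨P, hP.isPrime⟩
  have hy : hU.fromSpec y ∈ U := by
    rw [← SetLike.mem_coe, ← hU.range_fromSpec]
    exact ⟨y, rfl⟩
  let : Algebra Γ(X, U) (X.presheaf.stalk (hU.fromSpec y)) :=
    TopCat.Presheaf.algebra_section_stalk X.presheaf ⟨_, hy⟩
  have : IsLocalization P.primeCompl (X.presheaf.stalk (hU.fromSpec y)) :=
    hU.isLocalization_stalk' y hy
  have := (hX (hU.fromSpec y)).2
  exact .of_equiv (IsLocalization.algEquiv P.primeCompl (X.presheaf.stalk (hU.fromSpec y))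
    (Localization.AtPrime P)).toRingEquiv

lemma isNormalScheme_of_forall_exists {X : Scheme.{u}} [IsIntegral X]
    (h : ∀ x : X, ∃ U : X.Opens, x ∈ U ∧ IsAffineOpen U ∧ IsIntegrallyClosed Γ(X, U)) :
    IsNormalScheme X := by
  intro x
  refine ⟨inferInstance, ?_⟩
  obtain ⟨U, hx, hU, hn⟩ := h x
  have : Nonempty U := ⟨⟨x, hx⟩⟩
  let : Algebra Γ(X, U) (X.presheaf.stalk x) :=
    TopCat.Presheaf.algebra_section_stalk X.presheaf ⟨_, hx⟩
  have := hU.isLocalization_stalk ⟨x, hx⟩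
  exact isIntegrallyClosed_of_isLocalization _ _
    (hU.primeIdealOf ⟨x, hx⟩).asIdeal.primeCompl_le_nonZeroDivisors

lemma functionFieldMap_germToFunctionField {X Y : Scheme.{u}} [IsIntegral X] [IsIntegral Y]
    (f : Y ⟶ X) [IsDominant f] (U : X.Opens) [Nonempty U] [Nonempty (f ⁻¹ᵁ U)] (a : Γ(X, U)) :
    functionFieldMap f (X.germToFunctionField U a) =
      Y.germToFunctionField (f ⁻¹ᵁ U) (f.app U a) := by
  have h1 : genericPoint X ∈ U := ((genericPoint_spec X).mem_open_set_iff U.isOpen).mpr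
    (by simpa using ‹Nonempty U›)
  have h2 : genericPoint Y ∈ f ⁻¹ᵁ U :=
    ((genericPoint_spec Y).mem_open_set_iff (f ⁻¹ᵁ U).isOpen).mpr
      (by simpa using ‹Nonempty (f ⁻¹ᵁ U)›)
  have : X.presheaf.germ U _ h1 ≫
      X.presheaf.stalkSpecializes (map_genericPoint_specializes f) ≫ f.stalkMap (genericPoint Y) =
      f.app U ≫ Y.presheaf.germ (f ⁻¹ᵁ U) _ h2 := by
    rw [TopCat.Presheaf.germ_stalkSpecializes_assoc, Scheme.Hom.germ_stalkMap]
  exact congr(($this).hom a)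

lemma nonempty_preimage_of_isDominant {X Y : Scheme.{u}} (f : Y ⟶ X) [IsDominant f] (U : X.Opens)
    [h : Nonempty U] : Nonempty (f ⁻¹ᵁ U) := by
  obtain ⟨⟨x, hx⟩⟩ := h
  obtain ⟨_, hU, y, rfl⟩ := f.denseRange.inter_open_nonempty U U.isOpen ⟨x, hx⟩
  exact ⟨⟨y, hU⟩⟩

lemma le_preimage_top {X Y : Scheme.{u}} (f : X ⟶ Y) (U : X.Opens) : U ≤ f ⁻¹ᵁ ⊤ :=
  fun _ _ ↦ trivial

/-- The homomorphism `K → Γ(X, U)` given by the structure morphism of a `K`-scheme. -/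
def structureMap {K : CommRingCat.{u}} {X : Scheme.{u}} (p : X ⟶ Spec K) (U : X.Opens) :
    K ⟶ Γ(X, U) :=
  (Scheme.ΓSpecIso K).inv ≫ p.appLE ⊤ U (le_preimage_top p U)

/-- Sections of the pullback of two morphisms of schemes to an affine scheme, one of them from
an affine scheme. -/
lemma isPushout_app_structureMap {K E : CommRingCat.{u}} {X Z : Scheme.{u}} {p : X ⟶ Spec K}
    {f : K ⟶ E} {q : Z ⟶ X} {r : Z ⟶ Spec E} (h : IsPullback q r p (Spec.map f)) {U : X.Opens}
    (hU : IsAffineOpen U) :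
    IsPushout (structureMap p U) f (q.app U) (structureMap r (q ⁻¹ᵁ U)) := by
  have h := (isIso_pushoutSection_iff h (US := ⊤) (UT := ⊤)
    (UX := U) (UY := q ⁻¹ᵁ U) le_top le_top (by simp)).mp
    (isIso_pushoutSection_of_isAffineOpen _ _ _ _ (isAffineOpen_top _) (isAffineOpen_top _) hU)
  refine IsPushout.of_iso h (Scheme.ΓSpecIso K) (Iso.refl _) (Scheme.ΓSpecIso E) (Iso.refl _)
    ?_ ?_ ?_ ?_
  · simp [structureMap]
  · rw [← Scheme.ΓSpecIso_naturality]
    have : (Spec.map f).appTop = (Spec.map f).appLE ⊤ ⊤ le_top := Scheme.Hom.app_eq_appLE _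
    rw [this]
  · simp [Scheme.Hom.app_eq_appLE]
  · simp [structureMap]

/-- Sections of the pullback along a morphism `q` that is affine over `U`. -/
lemma isPushout_app_app {X Y X' Y' : Scheme.{u}} {φ : Y ⟶ X} {q : X' ⟶ X} {φ' : Y' ⟶ X'}
    {q' : Y' ⟶ Y} (h : IsPullback q' φ' φ q) {U : X.Opens} (hU : IsAffineOpen U) [IsAffineHom φ]
    {V : X'.Opens} (hV : IsAffineOpen V) (hVU : V ≤ q ⁻¹ᵁ U)
    (hW : φ' ⁻¹ᵁ V ≤ q' ⁻¹ᵁ φ ⁻¹ᵁ U) :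
    IsPushout (φ.app U) (q.appLE U V hVU) (q'.appLE (φ ⁻¹ᵁ U) (φ' ⁻¹ᵁ V) hW) (φ'.app V) := by
  have h := (isIso_pushoutSection_iff h (US := U) (UT := V)
    (UX := φ ⁻¹ᵁ U) (UY := φ' ⁻¹ᵁ V) hVU le_rfl (inf_eq_right.mpr hW).symm).mp
    (isIso_pushoutSection_of_isAffineOpen _ _ _ _ hU hV (hU.preimage φ))
  rw [Scheme.Hom.app_eq_appLE, Scheme.Hom.app_eq_appLE]
  exact h

/-- A pushout of commutative rings is generated by the images of the two factors. -/
lemma subring_eq_top_of_isPushout {R B R' D : CommRingCat.{u}} {i : R ⟶ B} {s : R ⟶ R'}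
    {j : B ⟶ D} {t : R' ⟶ D} (h : IsPushout i s j t) (S : Subring D) (hj : ∀ b, j.hom b ∈ S)
    (ht : ∀ r, t.hom r ∈ S) : S = ⊤ := by
  let j' : B ⟶ CommRingCat.of S := CommRingCat.ofHom (j.hom.codRestrict S hj)
  let t' : R' ⟶ CommRingCat.of S := CommRingCat.ofHom (t.hom.codRestrict S ht)
  have hw : i ≫ j' = s ≫ t' := by
    refine CommRingCat.hom_ext (RingHom.ext fun r ↦ Subtype.val_injective ?_)
    exact congr(($h.w).hom r)
  have hid : h.desc j' t' hw ≫ CommRingCat.ofHom S.subtype = 𝟙 D := by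
    apply h.hom_ext
    · rw [h.inl_desc_assoc, Category.comp_id]
      rfl
    · rw [h.inr_desc_assoc, Category.comp_id]
      rfl
  rw [eq_top_iff]
  intro d _
  have : S.subtype ((h.desc j' t' hw).hom d) = d := congr(($hid).hom d)
  rw [← this]
  exact Subtype.property _

lemma app_injective_of_isDominant {X Y : Scheme.{u}} [IsIntegral X] [IsIntegral Y] (f : Y ⟶ X)
    [IsDominant f] (U : X.Opens) [Nonempty U] : Function.Injective (f.app U) := by
  have := nonempty_preimage_of_isDominant f U
  intro a b hab
  apply X.germToFunctionField_injective U
  apply (functionFieldMap f).injective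
  rw [functionFieldMap_germToFunctionField, functionFieldMap_germToFunctionField, hab]

lemma surjective_SpecMap_of_field {K E : Type u} [Field K] [Field E] (f : K →+* E) :
    Surjective (Spec.map (CommRingCat.ofHom f)) := by
  have : Subsingleton (Spec (CommRingCat.of K)) :=
    inferInstanceAs (Subsingleton (PrimeSpectrum K))
  have : Nonempty (Spec (CommRingCat.of E)) := inferInstanceAs (Nonempty (PrimeSpectrum E))
  exact ⟨Function.surjective_to_subsingleton _⟩

/-- The base change of a normal variety in characteristic zero to an algebraic extension of the
ground field is normal, as soon as it is integral. -/
lemma IsNormalScheme.of_isPullback {K E : Type u} [Field K] [CharZero K] [Field E] [Algebra K E]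
    [Algebra.IsAlgebraic K E] {X Z : Scheme.{u}} [IsIntegral X] [IsIntegral Z]
    (hX : IsNormalScheme X) {p : X ⟶ Spec (.of K)} {q : Z ⟶ X} {r : Z ⟶ Spec (.of E)}
    (h : IsPullback q r p (Spec.map (CommRingCat.ofHom (algebraMap K E)))) :
    IsNormalScheme Z := by
  have : IsAffineHom q := MorphismProperty.of_isPullback h.flip inferInstance
  have : Surjective q := MorphismProperty.of_isPullback h.flip (surjective_SpecMap_of_field _)
  refine isNormalScheme_of_forall_exists fun x ↦ ?_
  obtain ⟨U, hU, hxU, -⟩ := exists_isAffineOpen_mem_and_subset (x := q x) (U := ⊤) trivial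
  refine ⟨q ⁻¹ᵁ U, hxU, hU.preimage _, ?_⟩
  have : Nonempty U := ⟨⟨_, hxU⟩⟩
  have := hX.isIntegrallyClosed hU
  have : Nonempty (q ⁻¹ᵁ U) := ⟨⟨x, hxU⟩⟩
  have hpush := isPushout_app_structureMap h hU
  let : Algebra K Γ(X, U) := (structureMap p U).hom.toAlgebra
  let : Algebra Γ(X, U) Γ(Z, q ⁻¹ᵁ U) := (q.app U).hom.toAlgebra
  let : Algebra K Γ(Z, q ⁻¹ᵁ U) := ((q.app U).hom.comp (structureMap p U).hom).toAlgebra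
  have : IsScalarTower K Γ(X, U) Γ(Z, q ⁻¹ᵁ U) := .of_algebraMap_eq fun _ ↦ rfl
  have : FaithfulSMul Γ(X, U) Γ(Z, q ⁻¹ᵁ U) :=
    (faithfulSMul_iff_algebraMap_injective _ _).mpr (app_injective_of_isDominant q U)
  let ι : E →ₐ[K] Γ(Z, q ⁻¹ᵁ U) := ⟨(structureMap r (q ⁻¹ᵁ U)).hom, fun r ↦
    congr(($hpush.w).hom r).symm⟩
  -- The sections over the preimage of U are the pushout of Γ(X, U) and E over K, hence generated by
  -- E over Γ(X, U).
  refine isIntegrallyClosed_of_adjoin_eq_top (R := Γ(X, U)) ι ?_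
  have := subring_eq_top_of_isPushout hpush
    (Algebra.adjoin Γ(X, U) (Set.range ι)).toSubring (fun b ↦ Subalgebra.algebraMap_mem _ b)
    (fun e ↦ Algebra.subset_adjoin ⟨e, rfl⟩)
  rw [eq_top_iff]
  intro d _
  have hd : d ∈ (⊤ : Subring Γ(Z, q ⁻¹ᵁ U)) := trivial
  rwa [← this] at hd

end

section

/-! ### Normalization in an extension of the function field -/

section Normalization

variable (X : Scheme.{u}) [IsIntegral X] (M : Type u) [Field M] [Algebra X.functionField M]

/-- The generic point of `X` with values in an extension of the function field. -/
def genericSpec : Spec (.of M) ⟶ X :=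
  Spec.map (CommRingCat.ofHom (algebraMap X.functionField M)) ≫ X.fromSpecStalk (genericPoint X)

lemma genericSpec_apply (y : Spec (.of M)) : genericSpec X M y = genericPoint X := by
  have h1 : (Spec.map (CommRingCat.ofHom (algebraMap X.functionField M))) y =
      IsLocalRing.closedPoint X.functionField := Subsingleton.elim
        (α := PrimeSpectrum X.functionField) _ _
  rw [genericSpec, Scheme.Hom.comp_apply, h1]
  exact Scheme.fromSpecStalk_closedPoint

lemma genericSpec_preimage (U : X.Opens) [h : Nonempty U] : genericSpec X M ⁻¹ᵁ U = ⊤ := by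
  rw [eq_top_iff]
  intro y _
  change genericSpec X M y ∈ U
  rw [genericSpec_apply]
  exact ((genericPoint_spec X).mem_open_set_iff U.isOpen).mpr (by simpa using h)

lemma genericSpec_appLE (U : X.Opens) [Nonempty U] :
    (genericSpec X M).appLE U ⊤ (genericSpec_preimage X M U).ge ≫ (Scheme.ΓSpecIso (.of M)).hom =
      X.germToFunctionField U ≫ CommRingCat.ofHom (algebraMap X.functionField M) := by
  have h : genericPoint X ∈ U :=
    ((genericPoint_spec X).mem_open_set_iff U.isOpen).mpr (by simpa using ‹Nonempty U›)
  have h1 : (⊤ : (Spec X.functionField).Opens) ≤ X.fromSpecStalk (genericPoint X) ⁻¹ᵁ U := by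
    intro y _
    have : y = IsLocalRing.closedPoint X.functionField := Subsingleton.elim
        (α := PrimeSpectrum X.functionField) _ _
    change X.fromSpecStalk (genericPoint X) y ∈ U
    rw [this]
    erw [Scheme.fromSpecStalk_closedPoint]
    exact h
  have h2 : (X.fromSpecStalk (genericPoint X)).appLE U ⊤ h1 =
      X.germToFunctionField U ≫ (Scheme.ΓSpecIso X.functionField).inv := by
    rw [Scheme.Hom.appLE, Scheme.fromSpecStalk_app h]
    simp only [Category.assoc, ← Functor.map_comp]
    congr 1
  have h3 : (genericSpec X M).appLE U ⊤ (genericSpec_preimage X M U).ge =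
      (X.fromSpecStalk (genericPoint X)).appLE U ⊤ h1 ≫
        (Spec.map (CommRingCat.ofHom (algebraMap X.functionField M))).appTop := by
    let g := Spec.map (CommRingCat.ofHom (algebraMap X.functionField M))
    have hg : ⊤ ≤ g ⁻¹ᵁ ⊤ := fun _ _ ↦ trivial
    have : g.appTop = g.appLE ⊤ ⊤ hg := Scheme.Hom.app_eq_appLE _
    change _ = _ ≫ g.appTop
    rw [this]
    exact (Scheme.Hom.appLE_comp_appLE _ _ U ⊤ ⊤ h1 hg).symm
  rw [h3, h2, Category.assoc, Category.assoc, Scheme.ΓSpecIso_naturality]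
  erw [Iso.inv_hom_id_assoc]
  rfl

instance : IsDominant (genericSpec X M) := by
  have : Nonempty (Spec (.of M)) := inferInstanceAs (Nonempty (PrimeSpectrum M))
  obtain ⟨y⟩ := this
  refine ⟨fun x ↦ ?_⟩
  have h1 : genericPoint X ∈ Set.range (genericSpec X M) := ⟨y, genericSpec_apply X M y⟩
  exact closure_mono (Set.singleton_subset_iff.mpr h1)
    (by rw [(genericPoint_spec X).def]; trivial)

/-- The normalization of `X` in an extension of its function field. -/
abbrev normalizationIn : Scheme.{u} := (genericSpec X M).normalization

/-- The projection of the normalization of `X` in an extension of its function field. -/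
abbrev normalizationInMap : normalizationIn X M ⟶ X := (genericSpec X M).fromNormalization

lemma top_le_toNormalization_preimage (U : X.Opens) [Nonempty U] :
    (⊤ : (Spec (.of M)).Opens) ≤
      (genericSpec X M).toNormalization ⁻¹ᵁ normalizationInMap X M ⁻¹ᵁ U := by
  rw [← Scheme.Hom.comp_preimage, Scheme.Hom.toNormalization_fromNormalization,
    genericSpec_preimage]

/-- The sections of the normalization as elements of the extension field. -/
def normalizationSections (U : X.Opens) [Nonempty U] :
    Γ(normalizationIn X M, normalizationInMap X M ⁻¹ᵁ U) ⟶ .of M :=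
  (genericSpec X M).toNormalization.appLE _ ⊤ (top_le_toNormalization_preimage X M U) ≫
    (Scheme.ΓSpecIso (.of M)).hom

lemma app_normalizationSections (U : X.Opens) [Nonempty U] :
    (normalizationInMap X M).app U ≫ normalizationSections X M U =
      X.germToFunctionField U ≫ CommRingCat.ofHom (algebraMap X.functionField M) := by
  rw [← genericSpec_appLE, normalizationSections, Scheme.Hom.app_eq_appLE,
    Scheme.Hom.appLE_comp_appLE_assoc]
  simp only [Scheme.Hom.toNormalization_fromNormalization]

variable {X} in
lemma normalizationSections_eq {U : X.Opens} (hU : IsAffineOpen U) [Nonempty U] :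
    letI := ((genericSpec X M).app U).hom.toAlgebra
    normalizationSections X M U = ((genericSpec X M).normalizationObjIso hU).hom ≫
      CommRingCat.ofHom
        (integralClosure Γ(X, U) Γ(Spec (.of M), genericSpec X M ⁻¹ᵁ U)).val.toRingHom ≫
      (Spec (.of M)).presheaf.map (eqToHom (genericSpec_preimage X M U).symm).op ≫
        (Scheme.ΓSpecIso (.of M)).hom := by
  have := (genericSpec X M).normalizationObjIso_hom_val hU
  rw [reassoc_of% this, normalizationSections]
  simp

-- T stands for the sections of Spec M over the preimage of U, which is everything. Hiding it behind
-- an isomorphism with M turns the description of the normalization into one by elements of M.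
variable {X} in
lemma exists_normalizationSections_eq {U : X.Opens} (hU : IsAffineOpen U) [Nonempty U] :
    ∃ (T : Type u) (_ : CommRing T) (_ : Algebra Γ(X, U) T) (j : T ≃+* M)
      (e : Γ(normalizationIn X M, normalizationInMap X M ⁻¹ᵁ U) ≃+* integralClosure Γ(X, U) T),
      (∀ a, normalizationSections X M U a = j (e a)) ∧
        ∀ r, j (algebraMap _ T r) = algebraMap X.functionField M (X.germToFunctionField U r) := by
  let := ((genericSpec X M).app U).hom.toAlgebra
  let j : Γ(Spec (.of M), genericSpec X M ⁻¹ᵁ U) ≅ .of M :=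
    (Spec (.of M)).presheaf.mapIso (eqToIso (genericSpec_preimage X M U).symm).op ≪≫
      Scheme.ΓSpecIso (.of M)
  have h := normalizationSections_eq M hU
  refine ⟨_, _, this, j.commRingCatIsoToRingEquiv,
    ((genericSpec X M).normalizationObjIso hU).commRingCatIsoToRingEquiv,
    fun a ↦ congr(($h).hom a), fun r ↦ ?_⟩
  have h2 := genericSpec_appLE X M U
  rw [Scheme.Hom.appLE, Category.assoc] at h2
  exact congr(($h2).hom r)

variable {X} in
lemma normalizationSections_injective {U : X.Opens} (hU : IsAffineOpen U) [Nonempty U] :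
    Function.Injective (normalizationSections X M U) := by
  obtain ⟨T, _, _, j, e, h, -⟩ := exists_normalizationSections_eq M hU
  intro a b hab
  rw [h, h] at hab
  exact e.injective (Subtype.val_injective (j.injective hab))

variable {X} in
lemma exists_normalizationSections_eq_iff {U : X.Opens} (hU : IsAffineOpen U) [Nonempty U]
    {m : M} : (∃ a, normalizationSections X M U a = m) ↔
      ((algebraMap X.functionField M).comp (X.germToFunctionField U).hom).IsIntegralElem m := by
  obtain ⟨T, _, _, j, e, h, hj⟩ := exists_normalizationSections_eq M hU
  have hj : (algebraMap X.functionField M).comp (X.germToFunctionField U).hom =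
      (j : T →+* M).comp (algebraMap _ T) := RingHom.ext fun r ↦ (hj r).symm
  have key (t : T) : ((algebraMap X.functionField M).comp
      (X.germToFunctionField U).hom).IsIntegralElem (j t) ↔ IsIntegral Γ(X, U) t := by
    rw [hj]
    refine exists_congr fun p ↦ and_congr_right fun _ ↦ ?_
    rw [← RingEquiv.coe_toRingHom, ← Polynomial.hom_eval₂]
    exact map_eq_zero_iff _ j.injective
  constructor
  · rintro ⟨a, rfl⟩
    rw [h, key]
    exact (e a).2
  · intro hm
    obtain ⟨t, rfl⟩ := j.surjective m
    rw [key] at hm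
    exact ⟨e.symm ⟨t, hm⟩, by rw [h, e.apply_symm_apply]⟩

end Normalization

end

section

/-! ### The normalization as a cover -/

section NormalizationCover

variable {X : Scheme.{u}} [IsIntegral X] (M : Type u) [Field M]
  [Algebra X.functionField M]

/-- An extension of the function field as an algebra over the sections on an open subset. -/
abbrev sectionsAlgebra (U : X.Opens) [Nonempty U] : Algebra Γ(X, U) M :=
  ((algebraMap X.functionField M).comp (X.germToFunctionField U).hom).toAlgebra

/-- Through this form, normality, finiteness and degree of the normalization reduce to standard
facts on integral closures in finite extensions of fraction fields. -/
lemma isIntegralClosure_normalizationIn {U : X.Opens} (hU : IsAffineOpen U) [Nonempty U] :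
    letI := sectionsAlgebra M U
    letI := (normalizationSections X M U).hom.toAlgebra
    IsIntegralClosure Γ(normalizationIn X M, normalizationInMap X M ⁻¹ᵁ U) Γ(X, U) M := by
  let := sectionsAlgebra M U
  let := (normalizationSections X M U).hom.toAlgebra
  exact ⟨normalizationSections_injective M hU, (exists_normalizationSections_eq_iff M hU).symm⟩

instance : IsDominant (normalizationInMap X M) := by
  have : IsDominant ((genericSpec X M).toNormalization ≫ normalizationInMap X M) := by
    rw [Scheme.Hom.toNormalization_fromNormalization]
    infer_instance
  exact .of_comp (genericSpec X M).toNormalization _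

variable [FiniteDimensional X.functionField M]

lemma isNormalScheme_normalizationIn : IsNormalScheme (normalizationIn X M) := by
  refine isNormalScheme_of_forall_exists fun x ↦ ?_
  obtain ⟨U, hU, hxU, -⟩ :=
    exists_isAffineOpen_mem_and_subset (x := normalizationInMap X M x) (U := ⊤) trivial
  have : Nonempty U := ⟨⟨_, hxU⟩⟩
  refine ⟨_, hxU, hU.preimage _, ?_⟩
  let := sectionsAlgebra M U
  let := (normalizationSections X M U).hom.toAlgebra
  let := ((normalizationInMap X M).app U).hom.toAlgebra
  have := isIntegralClosure_normalizationIn M hU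
  have := functionField_isFractionRing_of_isAffineOpen X U hU
  have : IsScalarTower Γ(X, U) X.functionField M := .of_algebraMap_eq fun _ ↦ rfl
  have : IsScalarTower Γ(X, U) Γ(normalizationIn X M, normalizationInMap X M ⁻¹ᵁ U) M :=
      .of_algebraMap_eq fun r ↦ congr(($(app_normalizationSections X M U)).hom r).symm
  have := integralClosure.isIntegrallyClosedOfFiniteExtension (R := Γ(X, U)) X.functionField
    (L := M)
  exact .of_equiv (IsIntegralClosure.equiv Γ(X, U) (integralClosure Γ(X, U) M) M
    Γ(normalizationIn X M, normalizationInMap X M ⁻¹ᵁ U)).toRingEquiv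

variable [IsLocallyNoetherian X] [Algebra.IsSeparable X.functionField M]

lemma isFinite_normalizationInMap (hX : IsNormalScheme X) : IsFinite (normalizationInMap X M) := by
  refine (isFinite_iff _).mpr ⟨inferInstance, fun U hU ↦ ?_⟩
  -- The comparison with M needs a nonempty U; over the empty open set the sections are the zero
  -- ring.
  rcases isEmpty_or_nonempty U with h | h
  · have : U = ⊥ := by
      ext x
      exact ⟨fun hx ↦ (h.false ⟨x, hx⟩).elim, fun hx ↦ hx.elim⟩
    subst this
    have : Subsingleton Γ(normalizationIn X M, normalizationInMap X M ⁻¹ᵁ ⊥) :=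
      inferInstanceAs (Subsingleton Γ(normalizationIn X M, ⊥))
    exact .of_surjective _ fun b ↦ ⟨0, Subsingleton.elim _ _⟩
  · let := sectionsAlgebra M U
    let := (normalizationSections X M U).hom.toAlgebra
    let := ((normalizationInMap X M).app U).hom.toAlgebra
    have := isIntegralClosure_normalizationIn M hU
    have := hX.isIntegrallyClosed hU
    have : IsNoetherianRing Γ(X, U) := IsLocallyNoetherian.component_noetherian ⟨U, hU⟩
    have := functionField_isFractionRing_of_isAffineOpen X U hU
    have : IsScalarTower Γ(X, U) X.functionField M := .of_algebraMap_eq fun _ ↦ rfl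
    have : IsScalarTower Γ(X, U) Γ(normalizationIn X M, normalizationInMap X M ⁻¹ᵁ U) M :=
      .of_algebraMap_eq fun r ↦ congr(($(app_normalizationSections X M U)).hom r).symm
    exact IsIntegralClosure.finite Γ(X, U) X.functionField M _

lemma isCover_normalizationInMap (hX : IsNormalScheme X) : IsCover (normalizationInMap X M) where
  isFinite := isFinite_normalizationInMap M hX
  isDominant := inferInstance
  isIntegral_source := inferInstance
  isNormal_source := isNormalScheme_normalizationIn M
  isNormal_target := hX

lemma degree_normalizationInMap (hX : IsNormalScheme X) :
    (isCover_normalizationInMap M hX).degree = Module.finrank X.functionField M := by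
  obtain ⟨U, hU, hxU, -⟩ :=
    exists_isAffineOpen_mem_and_subset (x := genericPoint X) (U := ⊤) trivial
  have : Nonempty U := ⟨⟨_, hxU⟩⟩
  have := nonempty_preimage_of_isDominant (normalizationInMap X M) U
  let := sectionsAlgebra M U
  let := (normalizationSections X M U).hom.toAlgebra
  let := ((normalizationInMap X M).app U).hom.toAlgebra
  have := isIntegralClosure_normalizationIn M hU
  have := functionField_isFractionRing_of_isAffineOpen X U hU
  have : IsScalarTower Γ(X, U) X.functionField M := .of_algebraMap_eq fun _ ↦ rfl
  have : IsScalarTower Γ(X, U) Γ(normalizationIn X M, normalizationInMap X M ⁻¹ᵁ U) M :=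
      .of_algebraMap_eq fun r ↦ congr(($(app_normalizationSections X M U)).hom r).symm
  have : IsFractionRing Γ(normalizationIn X M, normalizationInMap X M ⁻¹ᵁ U) M :=
    IsIntegralClosure.isFractionRing_of_finite_extension Γ(X, U) X.functionField M _
  have := functionField_isFractionRing_of_isAffineOpen _ _ (hU.preimage (normalizationInMap X M))
  let e : (normalizationIn X M).functionField ≃+* M := (IsLocalization.algEquiv (nonZeroDivisors
    Γ(normalizationIn X M, normalizationInMap X M ⁻¹ᵁ U)) _ M).toRingEquiv
  unfold IsCover.degree
  let : Algebra X.functionField (normalizationIn X M).functionField :=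
    (isCover_normalizationInMap M hX).fieldMap.toAlgebra
  refine Algebra.finrank_eq_of_equiv_equiv (RingEquiv.refl _) e ?_
  refine IsLocalization.ringHom_ext (nonZeroDivisors Γ(X, U)) (RingHom.ext fun r ↦ ?_)
  change algebraMap X.functionField M (X.germToFunctionField U r) =
    e (functionFieldMap (normalizationInMap X M) (X.germToFunctionField U r))
  rw [functionFieldMap_germToFunctionField]
  refine Eq.trans congr(($(app_normalizationSections X M U)).hom r).symm ?_
  exact (IsLocalization.algEquiv (nonZeroDivisors
    Γ(normalizationIn X M, normalizationInMap X M ⁻¹ᵁ U)) _ M).commutes _ |>.symm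

end NormalizationCover

/-! ### Lifting points along affine morphisms -/

section RationalPoints

variable {X Y : Scheme.{u}} {E : CommRingCat.{u}}

/-- The evaluation of sections at a point with values in an affine scheme. -/
def evalAt (x : Spec E ⟶ X) (U : X.Opens) (h : ⊤ ≤ x ⁻¹ᵁ U) : Γ(X, U) ⟶ E :=
  x.appLE U ⊤ h ≫ (Scheme.ΓSpecIso E).hom

lemma SpecMap_evalAt_fromSpec (x : Spec E ⟶ X) {U : X.Opens} (hU : IsAffineOpen U)
    (h : ⊤ ≤ x ⁻¹ᵁ U) : Spec.map (evalAt x U h) ≫ hU.fromSpec = x := by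
  rw [evalAt, Spec.map_comp, Category.assoc,
    IsAffineOpen.SpecMap_appLE_fromSpec x hU (isAffineOpen_top _) h, IsAffineOpen.fromSpec_top]
  simp [Scheme.isoSpec]

/-- The preimage of U is affine, so extending the evaluation at x to its sections is the same as
lifting x. -/
lemma exists_lift_of_app_comp_eq_evalAt (ν : Y ⟶ X) [IsAffineHom ν] (x : Spec E ⟶ X)
    {U : X.Opens} (hU : IsAffineOpen U) (h : ⊤ ≤ x ⁻¹ᵁ U) (t : Γ(Y, ν ⁻¹ᵁ U) ⟶ E)
    (ht : ν.app U ≫ t = evalAt x U h) : ∃ y : Spec E ⟶ Y, y ≫ ν = x := by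
  refine ⟨Spec.map t ≫ (hU.preimage ν).fromSpec, ?_⟩
  rw [Category.assoc, ← IsAffineOpen.SpecMap_appLE_fromSpec ν hU (hU.preimage ν) le_rfl,
    ← Spec.map_comp_assoc, ← Scheme.Hom.app_eq_appLE, ht, SpecMap_evalAt_fromSpec]

end RationalPoints

end

section

open Polynomial

/-! ### Specialization of the defining polynomial of a cover -/

/-- The base change of a finite Galois extension generated by a root of `g` is Galois, if `g`
remains irreducible. -/
lemma isGalois_adjoinRoot_map {F L F' : Type*} [Field F] [Field L] [Field F'] [CharZero F']
    [Algebra F L] [FiniteDimensional F L] [IsGalois F L] {b : L}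
    (hb : IntermediateField.adjoin F {b} = ⊤) (q : F →+* F')
    {g : F'[X]} (hg : (minpoly F b).map q = g) [hirr : Fact (Irreducible g)] :
    IsGalois F' (AdjoinRoot g) := by
  have hint : IsIntegral F b := Algebra.IsIntegral.isIntegral b
  let pb := PowerBasis.ofAdjoinEqTop hint (by
    rw [← IntermediateField.adjoin_simple_toSubalgebra_of_isAlgebraic hint.isAlgebraic, hb,
      IntermediateField.top_toSubalgebra])
  have hpb : pb.gen = b := PowerBasis.ofAdjoinEqTop_gen hint _
  let : Algebra F (AdjoinRoot g) := ((algebraMap F' (AdjoinRoot g)).comp q).toAlgebra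
  -- The minimal polynomial of b splits in the normal extension L, and ψ transports the splitting to
  -- g.
  let ψ : L →ₐ[F] AdjoinRoot g := pb.lift (AdjoinRoot.root g) (by
    rw [hpb, aeval_def]
    change eval₂ ((AdjoinRoot.of g).comp q) _ _ = 0
    rw [← eval₂_map, hg]
    exact AdjoinRoot.eval₂_root g)
  have hsplit : (g.map (algebraMap F' (AdjoinRoot g))).Splits := by
    have h1 := (Normal.splits (F := F) inferInstance b).map (ψ : L →+* AdjoinRoot g)
    rw [Polynomial.map_map, AlgHom.comp_algebraMap] at h1
    rw [← congrArg (Polynomial.map (algebraMap F' (AdjoinRoot g))) hg, Polynomial.map_map]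
    exact h1
  have hsf : g.IsSplittingField F' (AdjoinRoot g) := by
    refine ⟨hsplit, ?_⟩
    rw [eq_top_iff, ← AdjoinRoot.adjoinRoot_eq_top]
    refine Algebra.adjoin_mono (Set.singleton_subset_iff.mpr ?_)
    rw [mem_rootSet]
    exact ⟨hirr.out.ne_zero, by rw [aeval_def]; exact AdjoinRoot.eval₂_root g⟩
  exact IsGalois.of_separable_splitting_field hirr.out.separable

lemma minpoly_eq_of_forall_dvd {R S : Type*} [CommRing R] [IsDomain R] [IsIntegrallyClosed R]
    [CommRing S] [IsDomain S] [Algebra R S] [Module.IsTorsionFree R S] {b : S} {f : R[X]}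
    (hf : f.Monic) (hfb : aeval b f = 0) (hdvd : ∀ p : R[X], aeval b p = 0 → f ∣ p) :
    minpoly R b = f := by
  have hint : IsIntegral R b := ⟨f, hf, hfb⟩
  exact eq_of_monic_of_associated (minpoly.monic hint) hf (associated_of_dvd_dvd
    (minpoly.isIntegrallyClosed_dvd hint hfb) (hdvd _ (minpoly.aeval _ _)))

lemma minpoly_root_eq {R F : Type*} [CommRing R] [IsDomain R] [IsIntegrallyClosed R] [Field F]
    [Algebra R F] [IsFractionRing R F] {f : R[X]} (hf : f.Monic)
    [hirr : Fact (Irreducible (f.map (algebraMap R F)))] :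
    minpoly R (AdjoinRoot.root (f.map (algebraMap R F))) = f := by
  have hroot : aeval (AdjoinRoot.root (f.map (algebraMap R F))) f = 0 := by
    rw [← aeval_map_algebraMap F, aeval_def]
    exact AdjoinRoot.eval₂_root _
  have hint : IsIntegral R (AdjoinRoot.root (f.map (algebraMap R F))) := ⟨f, hf, hroot⟩
  apply Polynomial.map_injective _ (IsFractionRing.injective R F)
  rw [← minpoly.isIntegrallyClosed_eq_field_fractions' F hint,
    AdjoinRoot.minpoly_root hirr.out.ne_zero, (hf.map _).leadingCoeff, inv_one, map_one, mul_one]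

/-- If the specialization of the polynomial of a Galois cover is reducible, then the
specialization lifts to one of finitely many intermediate extensions. -/
lemma exists_lift_of_not_irreducible_map {R F E : Type u} [CommRing R] [IsDomain R]
    [IsIntegrallyClosed R] [Field F] [Algebra R F] [IsFractionRing R F] [Field E] [CharZero E]
    {f : R[X]} (hf : f.Monic) (hsep : f.Separable)
    [hirr : Fact (Irreducible (f.map (algebraMap R F)))]
    [IsGalois F (AdjoinRoot (f.map (algebraMap R F)))] (s : R →+* E)
    (hs : Function.Surjective s) (hred : ¬ Irreducible (f.map s)) :
    ∃ M : IntermediateField F (AdjoinRoot (f.map (algebraMap R F))), M ≠ ⊥ ∧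
      ∀ (C : Type u) [CommRing C] (i : R →+* C) (j : C →+* M),
        (∀ c, ((algebraMap F M).comp (algebraMap R F)).IsIntegralElem (j c)) →
        j.comp i = (algebraMap F M).comp (algebraMap R F) → ∃ t : C →+* E, t.comp i = s := by
  have hroot : aeval (AdjoinRoot.root (f.map (algebraMap R F))) f = 0 := by
    rw [← aeval_map_algebraMap F, aeval_def]
    exact AdjoinRoot.eval₂_root _
  have : FiniteDimensional F (AdjoinRoot (f.map (algebraMap R F))) :=
    (AdjoinRoot.powerBasis hirr.out.ne_zero).finite
  by_contra h
  push Not at h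
  have hmin := minpoly_root_eq (F := F) hf
  apply hred
  rw [← hmin]
  refine irreducible_map_of_forall_intermediateField (F := F) s hs (AdjoinRoot.root _) ⟨f, hf, hroot⟩
    (by rw [hmin]; exact hsep.map) fun M hM ↦ ?_
  rintro ⟨t, ht⟩
  obtain ⟨C, _, i, j, hj, hij, hC⟩ := h M hM
  have halg : algebraMap R M = (algebraMap F M).comp (algebraMap R F) :=
    IsScalarTower.algebraMap_eq R F M
  -- An extension of s to the integral closure restricts to C. In the application C is the ring of
  -- sections of the normalization in M.
  let j' : C →+* integralClosure R M := j.codRestrict (integralClosure R M) fun c ↦ by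
    rw [← halg] at hj
    exact hj c
  refine hC (t.comp j') (ht ▸ RingHom.ext fun r ↦ congrArg t (Subtype.ext ?_))
  change j (i r) = algebraMap R M r
  rw [halg, ← hij]
  rfl

end

section

/-! ### Thin sets -/

section Thin

variable {X S : Scheme.{u}} {p : X ⟶ S}

lemma IsThin.mono {A B : Set (RatPoint p)} (hB : IsThin B) (h : A ⊆ B) : IsThin A := by
  obtain ⟨C, h1, h2, h3⟩ := hB
  exact ⟨C, h1, h2, h.trans h3⟩

lemma IsThin.union {A B : Set (RatPoint p)} (hA : IsThin A) (hB : IsThin B) : IsThin (A ∪ B) := by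
  obtain ⟨C, h1, h2, h3⟩ := hA
  obtain ⟨D, g1, g2, g3⟩ := hB
  refine ⟨C ∪ D, h1.union g1, fun B hB ↦ hB.elim (h2 B) (g2 B), ?_⟩
  rw [Set.sUnion_union]
  exact Set.union_subset_union h3 g3

lemma isThin_pointsOn {W : Set X} (hW : IsClosed W) (h : W ≠ Set.univ) : IsThin (pointsOn p W) :=
  ⟨{pointsOn p W}, Set.finite_singleton _, by
    rintro _ rfl
    exact .inr ⟨W, hW, h, rfl⟩, by simp⟩

end Thin

/-- Constants evaluate to themselves because x is a section of p. This gives the surjectivity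
required of specialization maps. -/
lemma structureMap_evalAt {E : CommRingCat.{u}} {X : Scheme.{u}} {p : X ⟶ Spec E} (x : RatPoint p)
    (U : X.Opens) (h : ⊤ ≤ x.hom ⁻¹ᵁ U) : structureMap p U ≫ evalAt x.hom U h = 𝟙 E := by
  have h2 : (x.hom ≫ p).appLE ⊤ ⊤ (le_preimage_top _ _) = 𝟙 _ := by
    simp_rw [x.w, Scheme.Hom.appLE]
    exact (Category.id_comp _).trans ((Spec E).presheaf.map_id _)
  rw [structureMap, evalAt, Category.assoc, Scheme.Hom.appLE_comp_appLE_assoc, h2]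
  simp

lemma evalAt_surjective {E : CommRingCat.{u}} {X : Scheme.{u}} {p : X ⟶ Spec E} (x : RatPoint p)
    (U : X.Opens) (h : ⊤ ≤ x.hom ⁻¹ᵁ U) : Function.Surjective (evalAt x.hom U h).hom :=
  fun e ↦ ⟨structureMap p U e, congr(($(structureMap_evalAt x U h)).hom e)⟩

/-- The points at which the polynomial defining a Galois cover has a reducible specialization form
a thin set. -/
lemma isThin_setOf_not_irreducible {E : Type u} [Field E] [CharZero E] {X : Scheme.{u}}
    [IsIntegral X] [IsLocallyNoetherian X] (hX : IsNormalScheme X) (p : X ⟶ Spec (.of E))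
    {U : X.Opens} (hU : IsAffineOpen U) [Nonempty U] {f : Polynomial Γ(X, U)} (hf : f.Monic)
    (hsep : f.Separable)
    [hirr : Fact (Irreducible (f.map (algebraMap Γ(X, U) X.functionField)))]
    [IsGalois X.functionField (AdjoinRoot (f.map (algebraMap Γ(X, U) X.functionField)))] :
    IsThin {x : RatPoint p | ∃ h : ⊤ ≤ x.hom ⁻¹ᵁ U,
      ¬ Irreducible (f.map (evalAt x.hom U h).hom)} := by
  let L := AdjoinRoot (f.map (algebraMap Γ(X, U) X.functionField))
  have : FiniteDimensional X.functionField L := (AdjoinRoot.powerBasis hirr.out.ne_zero).finite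
  have : Finite (IntermediateField X.functionField L) :=
    (Field.exists_primitive_element_iff_finite_intermediateField X.functionField L).mp
      ⟨inferInstance, Field.exists_primitive_element _ _⟩
  -- The thin set comes from the normalizations of X in the finitely many nontrivial intermediate
  -- fields M, which are covers of degree [M : K(X)] > 1.
  refine ⟨(fun M : IntermediateField X.functionField L ↦
    imagePoints p (normalizationInMap X M)) '' {M | M ≠ ⊥}, (Set.toFinite _).image _, ?_, ?_⟩
  · rintro _ ⟨M, hM, rfl⟩
    refine .inl ⟨_, _, isCover_normalizationInMap M hX, ?_, rfl⟩
    rw [degree_normalizationInMap M hX]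
    have h1 : 0 < Module.finrank X.functionField M := Module.finrank_pos
    have h2 : Module.finrank X.functionField M ≠ 1 := fun h ↦
      hM (IntermediateField.finrank_eq_one_iff.mp h)
    omega
  · rintro (x : RatPoint p) ⟨h, hx⟩
    have := hX.isIntegrallyClosed hU
    have := functionField_isFractionRing_of_isAffineOpen X U hU
    obtain ⟨M, hM, hlift⟩ := exists_lift_of_not_irreducible_map (F := X.functionField) hf hsep
      (evalAt x.hom U h).hom (evalAt_surjective x U h) hx
    obtain ⟨t, ht⟩ := hlift _ ((normalizationInMap X M).app U).hom
      (normalizationSections X M U).hom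
      (fun c ↦ (exists_normalizationSections_eq_iff M hU).mp ⟨c, rfl⟩)
      (RingHom.ext fun r ↦ congr(($(app_normalizationSections X M U)).hom r))
    obtain ⟨y, hy⟩ := exists_lift_of_app_comp_eq_evalAt (normalizationInMap X M) x.hom hU h
      (CommRingCat.ofHom t) (CommRingCat.hom_ext ht)
    exact Set.mem_sUnion.mpr ⟨_, ⟨M, hM, rfl⟩, ⟨y, by rw [← Category.assoc, hy, x.w]⟩, hy⟩

end

section

open Polynomial

/-! ### The equation of a cover -/

/-- The ring homomorphism `i : R → B` identifies `B` with `R[T] / (f)`, the image of `T` being `b`,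
and `f` is monic and separable. -/
structure IsSimpleEtale {R B : Type*} [CommRing R] [CommRing B] (i : R →+* B) (f : R[X]) (b : B) :
    Prop where
  monic : f.Monic
  separable : f.Separable
  eval₂_eq_zero : eval₂ i b f = 0
  exists_eval₂_eq : ∀ c : B, ∃ p : R[X], eval₂ i b p = c
  dvd_of_eval₂_eq_zero : ∀ p : R[X], eval₂ i b p = 0 → f ∣ p

section Equation

variable {X Y : Scheme.{u}} [IsIntegral X] [IsIntegral Y] {φ : Y ⟶ X} [IsDominant φ]

/-- The sections of Y are finite, hence integral, over those of X, and integrally closed in their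
fraction field. -/
lemma IsCover.isIntegralClosure (h : IsCover φ) {U : X.Opens} (hU : IsAffineOpen U) [Nonempty U]
    [Nonempty (φ ⁻¹ᵁ U)] :
    letI : Algebra Γ(X, U) Y.functionField :=
      ((functionFieldMap φ).comp (X.germToFunctionField U).hom).toAlgebra
    IsIntegralClosure Γ(Y, φ ⁻¹ᵁ U) Γ(X, U) Y.functionField := by
  let : Algebra Γ(X, U) Y.functionField :=
    ((functionFieldMap φ).comp (X.germToFunctionField U).hom).toAlgebra
  let : Algebra Γ(X, U) Γ(Y, φ ⁻¹ᵁ U) := (φ.app U).hom.toAlgebra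
  have : IsScalarTower Γ(X, U) Γ(Y, φ ⁻¹ᵁ U) Y.functionField :=
    .of_algebraMap_eq fun r ↦ functionFieldMap_germToFunctionField φ U r
  have := h.isFinite
  have : Module.Finite Γ(X, U) Γ(Y, φ ⁻¹ᵁ U) := φ.finite_app U hU
  have := h.isNormal_source.isIntegrallyClosed (hU.preimage φ)
  have := functionField_isFractionRing_of_isAffineOpen Y (φ ⁻¹ᵁ U) (hU.preimage φ)
  exact IsIntegralClosure.of_isIntegrallyClosed _ _ _

/-- Module generators of the sections of Y over an affine open generate the function field of Y, and
they are integral. -/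
lemma IsCover.finite_functionFieldMap (h : IsCover φ) : (functionFieldMap φ).Finite := by
  obtain ⟨U, hU, hxU, -⟩ :=
    exists_isAffineOpen_mem_and_subset (x := genericPoint X) (U := ⊤) trivial
  have : Nonempty U := ⟨⟨_, hxU⟩⟩
  have := nonempty_preimage_of_isDominant φ U
  let : Algebra X.functionField Y.functionField := (functionFieldMap φ).toAlgebra
  let : Algebra Γ(X, U) Y.functionField :=
    ((functionFieldMap φ).comp (X.germToFunctionField U).hom).toAlgebra
  let : Algebra Γ(X, U) Γ(Y, φ ⁻¹ᵁ U) := (φ.app U).hom.toAlgebra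
  have : IsScalarTower Γ(X, U) X.functionField Y.functionField := .of_algebraMap_eq fun _ ↦ rfl
  have : IsScalarTower Γ(X, U) Γ(Y, φ ⁻¹ᵁ U) Y.functionField :=
    .of_algebraMap_eq fun r ↦ functionFieldMap_germToFunctionField φ U r
  have := h.isFinite
  have : Module.Finite Γ(X, U) Γ(Y, φ ⁻¹ᵁ U) := φ.finite_app U hU
  have := functionField_isFractionRing_of_isAffineOpen X U hU
  have := functionField_isFractionRing_of_isAffineOpen Y (φ ⁻¹ᵁ U) (hU.preimage φ)
  obtain ⟨T, hT⟩ := ‹Module.Finite Γ(X, U) Γ(Y, φ ⁻¹ᵁ U)›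
  have hint (c : Γ(Y, φ ⁻¹ᵁ U)) : IsIntegral Γ(X, U) (algebraMap _ Y.functionField c) :=
    (Algebra.IsIntegral.isIntegral (R := Γ(X, U)) c).algebraMap
  let N := IntermediateField.adjoin X.functionField
    ((algebraMap Γ(Y, φ ⁻¹ᵁ U) Y.functionField) '' T)
  have : FiniteDimensional X.functionField N :=
    IntermediateField.finiteDimensional_adjoin (by rintro _ ⟨c, -, rfl⟩; exact (hint c).tower_top)
  have hN (c : Γ(Y, φ ⁻¹ᵁ U)) : algebraMap _ Y.functionField c ∈ N := by
    have hc : c ∈ Submodule.span Γ(X, U) (T : Set Γ(Y, φ ⁻¹ᵁ U)) := hT ▸ trivial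
    induction hc using Submodule.span_induction with
    | mem c hc => exact IntermediateField.subset_adjoin _ _ ⟨c, hc, rfl⟩
    | zero => rw [map_zero]; exact zero_mem _
    | add c d _ _ hc hd => rw [map_add]; exact add_mem hc hd
    | smul r c _ hc =>
      rw [Algebra.smul_def, map_mul, ← IsScalarTower.algebraMap_apply,
        IsScalarTower.algebraMap_apply Γ(X, U) X.functionField]
      exact mul_mem (N.algebraMap_mem _) hc
  have htop : N = ⊤ := by
    rw [eq_top_iff]
    intro l _
    obtain ⟨c, d, -, rfl⟩ := IsFractionRing.div_surjective Γ(Y, φ ⁻¹ᵁ U) l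
    exact div_mem (hN c) (hN d)
  rw [htop] at this
  exact Module.Finite.equiv (IntermediateField.topEquiv (F := X.functionField)
    (E := Y.functionField)).toLinearEquiv

/-- Over a nonempty open subset, a cover with separable extension of function fields is given by
a separable polynomial. -/
lemma IsCover.exists_isSimpleEtale (h : IsCover φ)
    (hsep : letI := (functionFieldMap φ).toAlgebra
      Algebra.IsSeparable X.functionField Y.functionField) :
    ∃ (U : X.Opens) (_ : IsAffineOpen U) (_ : Nonempty U) (f : Γ(X, U)[X]) (b : Γ(Y, φ ⁻¹ᵁ U)),
      IsSimpleEtale (φ.app U).hom f b := by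
  obtain ⟨V, hV, hxV, -⟩ :=
    exists_isAffineOpen_mem_and_subset (x := genericPoint X) (U := ⊤) trivial
  have : Nonempty V := ⟨⟨_, hxV⟩⟩
  let : Algebra X.functionField Y.functionField := (functionFieldMap φ).toAlgebra
  let : Algebra Γ(X, V) Y.functionField :=
    ((functionFieldMap φ).comp (X.germToFunctionField V).hom).toAlgebra
  have : IsScalarTower Γ(X, V) X.functionField Y.functionField := .of_algebraMap_eq fun _ ↦ rfl
  have : FiniteDimensional X.functionField Y.functionField := h.finite_functionFieldMap
  have := functionField_isFractionRing_of_isAffineOpen X V hV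
  have := h.isNormal_target.isIntegrallyClosed hV
  obtain ⟨b, r, hr, hb, -, H⟩ := exists_primitive_integral (R := Γ(X, V)) (F := X.functionField)
    (L := Y.functionField)
  -- On this open set r is invertible, so b generates the integral closure, which is the ring of
  -- sections of Y, and its minimal polynomial is separable.
  let U := X.basicOpen r
  have hU : IsAffineOpen U := hV.basicOpen r
  have : Nonempty U := by
    rw [← not_isEmpty_iff]
    intro he
    apply hr
    rw [← basicOpen_eq_bot_iff]
    ext x
    exact ⟨fun hx ↦ (he.false ⟨x, hx⟩).elim, fun hx ↦ hx.elim⟩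
  have := nonempty_preimage_of_isDominant φ U
  let : Algebra Γ(X, V) Γ(X, U) := (X.presheaf.map (homOfLE (X.basicOpen_le r)).op).hom.toAlgebra
  let : Algebra Γ(X, U) Y.functionField :=
    ((functionFieldMap φ).comp (X.germToFunctionField U).hom).toAlgebra
  have : IsScalarTower Γ(X, U) X.functionField Y.functionField := .of_algebraMap_eq fun _ ↦ rfl
  have : IsScalarTower Γ(X, V) Γ(X, U) X.functionField := .of_algebraMap_eq fun a ↦
    (X.presheaf.germ_res_apply _ _ _ a).symm
  have : IsScalarTower Γ(X, V) Γ(X, U) Y.functionField := .of_algebraMap_eq fun a ↦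
    congrArg (functionFieldMap φ) (X.presheaf.germ_res_apply _ _ _ a).symm
  have := functionField_isFractionRing_of_isAffineOpen X U hU
  have := h.isNormal_target.isIntegrallyClosed hU
  obtain ⟨hgen, hsep⟩ := H Γ(X, U) (RingedSpace.isUnit_res_basicOpen _ r)
  have := h.isIntegralClosure hU
  have : FaithfulSMul Γ(X, U) Y.functionField := by
    rw [faithfulSMul_iff_algebraMap_injective]
    exact (functionFieldMap φ).injective.comp (X.germToFunctionField_injective U)
  have hbU : IsIntegral Γ(X, U) b := hb.tower_top
  obtain ⟨b, rfl⟩ := (IsIntegralClosure.isIntegral_iff (A := Γ(Y, φ ⁻¹ᵁ U))).mp hbU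
  have hinj := IsIntegralClosure.algebraMap_injective Γ(Y, φ ⁻¹ᵁ U) Γ(X, U) Y.functionField
  have heval (p : Γ(X, U)[X]) : algebraMap _ Y.functionField (eval₂ (φ.app U).hom b p) =
      aeval (algebraMap Γ(Y, φ ⁻¹ᵁ U) Y.functionField b) p := by
    rw [hom_eval₂, aeval_def]
    congr 1
    exact RingHom.ext fun a ↦ (functionFieldMap_germToFunctionField φ U a).symm
  refine ⟨U, hU, inferInstance, minpoly Γ(X, U) (algebraMap _ Y.functionField b), b, minpoly.monic hbU, hsep,
    hinj ?_, fun c ↦ ?_, fun p hp ↦ ?_⟩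
  · rw [heval, minpoly.aeval, map_zero]
  · have hc := hgen (algebraMap _ Y.functionField c) (IsIntegralClosure.isIntegral_iff.mpr ⟨c, rfl⟩)
    rw [Algebra.adjoin_singleton_eq_range_aeval] at hc
    obtain ⟨p, hp⟩ := hc
    exact ⟨p, hinj ((heval p).trans hp)⟩
  · exact minpoly.isIntegrallyClosed_dvd hbU (by rw [← heval, hp, map_zero])

end Equation

end

section

open Polynomial

/-! ### The equation at the generic point -/

section Generic

variable {X Y : Scheme.{u}} [IsIntegral X] [IsIntegral Y] {φ : Y ⟶ X} [IsDominant φ]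
  {U : X.Opens} [Nonempty U] [Nonempty (φ ⁻¹ᵁ U)] {f : Γ(X, U)[X]} {b : Γ(Y, φ ⁻¹ᵁ U)}

lemma germToFunctionField_eval₂ (p : Γ(X, U)[X]) (b : Γ(Y, φ ⁻¹ᵁ U)) :
    Y.germToFunctionField (φ ⁻¹ᵁ U) (eval₂ (φ.app U).hom b p) =
      eval₂ ((functionFieldMap φ).comp (X.germToFunctionField U).hom)
        (Y.germToFunctionField (φ ⁻¹ᵁ U) b) p := by
  have : (functionFieldMap φ).comp (X.germToFunctionField U).hom =
      (Y.germToFunctionField (φ ⁻¹ᵁ U)).hom.comp (φ.app U).hom :=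
    RingHom.ext fun a ↦ functionFieldMap_germToFunctionField φ U a
  rw [this]
  exact hom_eval₂ _ _ _ _

lemma IsSimpleEtale.adjoin_germToFunctionField (h : IsSimpleEtale (φ.app U).hom f b)
    (hV : IsAffineOpen (φ ⁻¹ᵁ U)) :
    letI := (functionFieldMap φ).toAlgebra
    IntermediateField.adjoin X.functionField {Y.germToFunctionField (φ ⁻¹ᵁ U) b} = ⊤ := by
  let := (functionFieldMap φ).toAlgebra
  have := functionField_isFractionRing_of_isAffineOpen Y (φ ⁻¹ᵁ U) hV
  have key (c : Γ(Y, φ ⁻¹ᵁ U)) : Y.germToFunctionField (φ ⁻¹ᵁ U) c ∈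
      IntermediateField.adjoin X.functionField {Y.germToFunctionField (φ ⁻¹ᵁ U) b} := by
    obtain ⟨p, rfl⟩ := h.exists_eval₂_eq c
    rw [germToFunctionField_eval₂, ← eval₂_map]
    exact IntermediateField.algebra_adjoin_le_adjoin _ _ (aeval_mem_adjoin_singleton _ _)
  rw [eq_top_iff]
  intro l _
  obtain ⟨c, d, -, rfl⟩ := IsFractionRing.div_surjective Γ(Y, φ ⁻¹ᵁ U) l
  exact div_mem (key c) (key d)

/-- Sections inject into the function field, so the relations of b there are still the multiples of
the monic polynomial f. -/
lemma IsSimpleEtale.minpoly_germToFunctionField (h : IsSimpleEtale (φ.app U).hom f b)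
    [IsIntegrallyClosed Γ(X, U)] :
    letI : Algebra Γ(X, U) Y.functionField :=
      ((functionFieldMap φ).comp (X.germToFunctionField U).hom).toAlgebra
    minpoly Γ(X, U) (Y.germToFunctionField (φ ⁻¹ᵁ U) b) = f := by
  let : Algebra Γ(X, U) Y.functionField :=
      ((functionFieldMap φ).comp (X.germToFunctionField U).hom).toAlgebra
  have : FaithfulSMul Γ(X, U) Y.functionField := by
    rw [faithfulSMul_iff_algebraMap_injective]
    exact (functionFieldMap φ).injective.comp (X.germToFunctionField_injective U)
  refine minpoly_eq_of_forall_dvd h.monic ?_ fun p hp ↦ h.dvd_of_eval₂_eq_zero p ?_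
  · refine (germToFunctionField_eval₂ f b).symm.trans ?_
    rw [h.eval₂_eq_zero, map_zero]
  · apply Y.germToFunctionField_injective (φ ⁻¹ᵁ U)
    rw [germToFunctionField_eval₂, map_zero]
    exact hp

lemma IsSimpleEtale.minpoly_functionField (h : IsSimpleEtale (φ.app U).hom f b)
    (hU : IsAffineOpen U) [IsIntegrallyClosed Γ(X, U)] :
    letI := (functionFieldMap φ).toAlgebra
    minpoly X.functionField (Y.germToFunctionField (φ ⁻¹ᵁ U) b) =
      f.map (algebraMap Γ(X, U) X.functionField) := by
  let := (functionFieldMap φ).toAlgebra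
  let : Algebra Γ(X, U) Y.functionField :=
      ((functionFieldMap φ).comp (X.germToFunctionField U).hom).toAlgebra
  have : IsScalarTower Γ(X, U) X.functionField Y.functionField := .of_algebraMap_eq fun _ ↦ rfl
  have := functionField_isFractionRing_of_isAffineOpen X U hU
  have hmin := h.minpoly_germToFunctionField
  have hint : IsIntegral Γ(X, U) (Y.germToFunctionField (φ ⁻¹ᵁ U) b) := by
    by_contra hb
    rw [minpoly.eq_zero hb] at hmin
    exact h.monic.ne_zero hmin.symm
  rw [minpoly.isIntegrallyClosed_eq_field_fractions' X.functionField hint, hmin]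

end Generic

/-! ### Fibres over rational points -/

section Fibre

variable {X Y : Scheme.{u}} {φ : Y ⟶ X} {K : CommRingCat.{u}}

lemma top_le_fst_preimage (x : Spec K ⟶ X) {U : X.Opens} (h : ⊤ ≤ x ⁻¹ᵁ U) :
    ⊤ ≤ pullback.fst φ x ⁻¹ᵁ φ ⁻¹ᵁ U := by
  rw [← Scheme.Hom.comp_preimage, pullback.condition, Scheme.Hom.comp_preimage]
  exact fun z _ ↦ h (x := (pullback.snd φ x : pullback φ x ⟶ Spec K) z) trivial

variable [IsAffineHom φ]

/-- Sections of the fibre of an affine morphism. -/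
lemma isPushout_evalAt (x : Spec K ⟶ X) {U : X.Opens} (hU : IsAffineOpen U)
    (h : ⊤ ≤ x ⁻¹ᵁ U) (hW : ⊤ ≤ pullback.fst φ x ⁻¹ᵁ φ ⁻¹ᵁ U) :
    IsPushout (φ.app U) (evalAt x U h) ((pullback.fst φ x).appLE (φ ⁻¹ᵁ U) ⊤ hW)
      ((Scheme.ΓSpecIso K).inv ≫ (pullback.snd φ x).appTop) := by
  refine IsPushout.of_iso (isPushout_app_app (IsPullback.of_hasPullback φ x) hU
    (isAffineOpen_top (Spec K)) h hW) (Iso.refl _) (Iso.refl _) (Scheme.ΓSpecIso K) (Iso.refl _)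
    ?_ ?_ ?_ ?_
  · simp
  · simp [evalAt]
  · simp
  · rw [Iso.hom_inv_id_assoc]
    exact Category.comp_id _

lemma IsSimpleEtale.exists_isIntegral_pullback [IsIntegral X] [IsIntegral Y] [IsDominant φ]
    {U : X.Opens} (hU : IsAffineOpen U)
    {f : Γ(X, U)[X]} {b : Γ(Y, φ ⁻¹ᵁ U)} (hf : IsSimpleEtale (φ.app U).hom f b)
    {K : Type u} [Field K] (x : Spec (.of K) ⟶ X) (h : ⊤ ≤ x ⁻¹ᵁ U)
    (hirr : Irreducible (f.map (evalAt x U h).hom)) :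
    ∃ (_ : IsIntegral (pullback φ x)) (θ : Γ(Y, φ ⁻¹ᵁ U) →+* (pullback φ x).functionField),
      θ.comp (φ.app U).hom = (groundFieldMap (pullback.snd φ x)).comp (evalAt x U h).hom ∧
      ∀ a, ∃ p : K[X], eval₂ (groundFieldMap (pullback.snd φ x)) (θ b) p = a := by
  have hW := top_le_fst_preimage (φ := φ) x h
  have hpush := isPushout_evalAt (φ := φ) x hU h hW
  obtain ⟨e, he, heb⟩ := exists_ringEquiv_adjoinRoot_of_isPushout hpush f b hf.eval₂_eq_zero
    hf.exists_eval₂_eq hf.dvd_of_eval₂_eq_zero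
  let := Fact.mk hirr
  -- The ring of the affine fibre is K[T]/(f_x), already a field, so passing to the function field
  -- changes nothing.
  have hfield : IsField Γ(pullback φ x, ⊤) := e.toMulEquiv.isField (Field.toIsField _)
  have : IsDomain Γ(pullback φ x, ⊤) := hfield.isDomain
  have : IsAffine (pullback φ x) := isAffine_of_isAffineHom (pullback.snd φ x)
  have : Nonempty ↥(pullback φ x : Scheme.{u}) := by
    rw [← not_isEmpty_iff]
    intro
    exact not_subsingleton Γ(pullback φ x, ⊤) inferInstance
  have hZ : IsIntegral (pullback φ x) := isIntegral_of_isAffine_of_isDomain _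
  have : Nonempty (⊤ : (pullback φ x).Opens) := ⟨⟨genericPoint _, trivial⟩⟩
  have := functionField_isFractionRing_of_isAffineOpen (pullback φ x) ⊤ (isAffineOpen_top _)
  have hbij := hfield.localization_map_bijective (Rₘ := (pullback φ x).functionField)
    (M := nonZeroDivisors Γ(pullback φ x, ⊤)) (fun h ↦ nonZeroDivisors.ne_zero h rfl)
  refine ⟨hZ, ((pullback φ x).germToFunctionField ⊤).hom.comp
    ((pullback.fst φ x).appLE (φ ⁻¹ᵁ U) ⊤ hW).hom, RingHom.ext fun a ↦ ?_, fun a ↦ ?_⟩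
  · exact congrArg ((pullback φ x).germToFunctionField ⊤) congr(($hpush.w).hom a)
  · obtain ⟨z, rfl⟩ := hbij.2 a
    obtain ⟨p, hp⟩ := AdjoinRoot.mk_surjective (e z)
    refine ⟨p, ?_⟩
    let t : K →+* Γ(pullback φ x, ⊤) :=
      ((Scheme.ΓSpecIso (.of K)).inv ≫ (pullback.snd φ x).appTop).hom
    let e' : Γ(pullback φ x, ⊤) →+* AdjoinRoot (f.map (evalAt x U h).hom) := e
    have hz : z = eval₂ t (((pullback.fst φ x).appLE (φ ⁻¹ᵁ U) ⊤ hW).hom b) p := by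
      apply e.injective
      change _ = e' _
      have ht : e'.comp t = AdjoinRoot.of (f.map (evalAt x U h).hom) := RingHom.ext he
      have hb : e' (((pullback.fst φ x).appLE (φ ⁻¹ᵁ U) ⊤ hW).hom b) = AdjoinRoot.root _ := heb
      rw [← hp, hom_eval₂, ht, hb]
      exact (AdjoinRoot.aeval_eq p).symm
    rw [hz]
    exact (hom_eval₂ p t ((pullback φ x).germToFunctionField ⊤).hom _).symm

/-- A fibre of a Galois cover given by an irreducible polynomial is Galois with the same group. -/
lemma IsSimpleEtale.isGaloisWithGroup_pullback [IsIntegral X] [IsIntegral Y] [IsDominant φ]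
    (hφ : IsCover φ) {G : Type*} [Group G] (hG : IsGaloisWithGroup (functionFieldMap φ) G)
    {U : X.Opens} (hU : IsAffineOpen U) [Nonempty U]
    {f : Γ(X, U)[X]} {b : Γ(Y, φ ⁻¹ᵁ U)} (hf : IsSimpleEtale (φ.app U).hom f b)
    {k K : Type u} [Field k] [Field K] [CharZero K] [Algebra k K]
    (hreg : IsRegularExtension (algebraMap k K)) {p : X ⟶ Spec (.of K)} (x : RatPoint p)
    (h : ⊤ ≤ x.hom ⁻¹ᵁ U)
    (hirr : Irreducible ((f.map (evalAt x.hom U h).hom).map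
      (algebraMap K (geometricField k K)))) :
    ∃ _ : IsIntegral (pullback φ x.hom),
      IsRegularExtension ((groundFieldMap (pullback.snd φ x.hom)).comp (algebraMap k K)) ∧
      IsGaloisWithGroup (groundFieldMap (pullback.snd φ x.hom)) G := by
  set s : Γ(X, U) →+* K := (evalAt x.hom U h).hom with hs
  have hfs : (f.map s).Monic := hf.monic.map s
  have hirrK : Irreducible (f.map s) := hfs.irreducible_of_irreducible_map _ _ hirr
  obtain ⟨hZ, θ, hθ, hsurj⟩ := hf.exists_isIntegral_pullback hU x.hom h hirrK
  refine ⟨hZ, ?_, ?_⟩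
  all_goals
    let : Algebra K (pullback φ x.hom).functionField :=
      (groundFieldMap (pullback.snd φ x.hom)).toAlgebra
    have hA : Algebra.adjoin K {θ b} = ⊤ := by
      rw [eq_top_iff]
      intro a _
      obtain ⟨q, rfl⟩ := hsurj a
      exact aeval_mem_adjoin_singleton _ _
  · refine isRegularExtension_of_irreducible_map hreg (f.map s) hfs hirr (θ b) ?_ hA
    rw [aeval_def, eval₂_map]
    have := hom_eval₂ f (φ.app U).hom θ b
    rw [hf.eval₂_eq_zero, map_zero, hθ] at this
    exact this.symm
  · have := nonempty_preimage_of_isDominant φ U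
    let : Algebra X.functionField Y.functionField := (functionFieldMap φ).toAlgebra
    let : Algebra Γ(X, U) Y.functionField :=
      ((functionFieldMap φ).comp (X.germToFunctionField U).hom).toAlgebra
    let : Algebra Γ(X, U) Γ(Y, φ ⁻¹ᵁ U) := (φ.app U).hom.toAlgebra
    have : IsScalarTower Γ(X, U) X.functionField Y.functionField := .of_algebraMap_eq fun _ ↦ rfl
    have : IsScalarTower Γ(X, U) Γ(Y, φ ⁻¹ᵁ U) Y.functionField :=
      .of_algebraMap_eq fun r ↦ functionFieldMap_germToFunctionField φ U r
    have := functionField_isFractionRing_of_isAffineOpen X U hU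
    have := hφ.isNormal_target.isIntegrallyClosed hU
    have := hφ.isIntegralClosure hU
    have : FiniteDimensional X.functionField Y.functionField := hφ.finite_functionFieldMap
    obtain ⟨hgal, ⟨ι⟩⟩ := hG
    -- This identifies the sections of Y with the integral closure used in
    -- `isGalois_of_irreducible_map`, so that θ becomes a specialization of it.
    let ε := IsIntegralClosure.equiv Γ(X, U) Γ(Y, φ ⁻¹ᵁ U) Y.functionField
      (integralClosure Γ(X, U) Y.functionField)
    have hε : (ε b : Y.functionField) = Y.germToFunctionField (φ ⁻¹ᵁ U) b :=
      IsIntegralClosure.algebraMap_equiv Γ(X, U) Γ(Y, φ ⁻¹ᵁ U) Y.functionField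
        (integralClosure Γ(X, U) Y.functionField) b
    let θ' : integralClosure Γ(X, U) Y.functionField →+* (pullback φ x.hom).functionField :=
      θ.comp (ε.symm : _ →+* Γ(Y, φ ⁻¹ᵁ U))
    have hθ' : θ' (ε b) = θ b := congrArg θ (ε.symm_apply_apply b)
    obtain ⟨h1, ⟨ι'⟩⟩ := isGalois_of_irreducible_map (F := X.functionField) s
      (evalAt_surjective x U h) (ε b)
      (by rw [hε]; exact hf.adjoin_germToFunctionField (hU.preimage φ))
      (by rw [hε, hf.minpoly_germToFunctionField]; exact hirrK) θ'
      (RingHom.ext fun r ↦ (congrArg θ (ε.symm.commutes r)).trans congr($hθ r))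
      (by rw [hθ']; exact hA)
    exact ⟨h1, ⟨ι'.trans ι⟩⟩

end Fibre

end

section

open Polynomial

/-! ### Base change -/

section BaseChange

variable {X Y X' Y' : Scheme.{u}} {φ : Y ⟶ X} {q : X' ⟶ X} {q' : Y' ⟶ Y} {φ' : Y' ⟶ X'}
  [IsIntegral X'] [IsDominant φ]
  {U : X.Opens} {f : Γ(X, U)[X]} {b : Γ(Y, φ ⁻¹ᵁ U)}

/-- The polynomial defining a cover remains irreducible after a base change with integral total
space. -/
lemma IsSimpleEtale.irreducible_map [IsIntegral Y']
    (hf : IsSimpleEtale (φ.app U).hom f b) [IsFinite φ]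
    [IsAffineHom q] (hX' : IsNormalScheme X') (h : IsPullback q' φ' φ q) (hU : IsAffineOpen U)
    [Nonempty (q ⁻¹ᵁ U)] :
    Irreducible ((f.map (q.app U).hom).map
      (algebraMap Γ(X', q ⁻¹ᵁ U) X'.functionField)) := by
  have hV : IsAffineOpen (q ⁻¹ᵁ U) := hU.preimage q
  have hsurj : Surjective φ := ⟨by
    rw [← Set.range_eq_univ, ← φ.isClosedMap.isClosed_range.closure_eq, φ.denseRange.closure_range]⟩
  have : Surjective φ' := MorphismProperty.of_isPullback h hsurj
  have : Nonempty (φ' ⁻¹ᵁ q ⁻¹ᵁ U) := nonempty_preimage_of_isDominant φ' _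
  have hW : φ' ⁻¹ᵁ q ⁻¹ᵁ U ≤ q' ⁻¹ᵁ φ ⁻¹ᵁ U := by
    rw [← Scheme.Hom.comp_preimage, ← Scheme.Hom.comp_preimage, h.w]
  have hpush := isPushout_app_app h hU hV le_rfl hW
  obtain ⟨e, -⟩ := exists_ringEquiv_adjoinRoot_of_isPushout hpush f b hf.eval₂_eq_zero
    hf.exists_eval₂_eq hf.dvd_of_eval₂_eq_zero
  rw [← Scheme.Hom.app_eq_appLE] at e
  have := hX'.isIntegrallyClosed hV
  have := functionField_isFractionRing_of_isAffineOpen X' _ hV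
  have hm : (f.map (q.app U).hom).Monic := hf.monic.map _
  -- By Gauss's lemma over an integrally closed domain, it suffices to work over Γ(X', q ⁻¹ᵁ U).
  -- There the quotient by f is the ring of sections of the integral scheme Y', so f generates a
  -- prime ideal.
  rw [← hm.irreducible_iff_irreducible_map_fraction_map]
  have hdom : IsDomain (AdjoinRoot (f.map (q.app U).hom)) := e.symm.toMulEquiv.isDomain _
  have hprime : (Ideal.span {f.map (q.app U).hom}).IsPrime :=
    (Ideal.Quotient.isDomain_iff_prime _).mp hdom
  exact ((Ideal.span_singleton_prime hm.ne_zero).mp hprime).irreducible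

lemma IsSimpleEtale.isGalois_adjoinRoot [IsIntegral X] [IsIntegral Y]
    (hf : IsSimpleEtale (φ.app U).hom f b)
    (hφ : IsCover φ) {G : Type*} [Group G] (hG : IsGaloisWithGroup (functionFieldMap φ) G) [IsDominant q]
    (hU : IsAffineOpen U) [Nonempty U] [Nonempty (q ⁻¹ᵁ U)] [CharZero X'.functionField]
    [Fact (Irreducible ((f.map (q.app U).hom).map
      (algebraMap Γ(X', q ⁻¹ᵁ U) X'.functionField)))] :
    IsGalois X'.functionField (AdjoinRoot ((f.map (q.app U).hom).map
      (algebraMap Γ(X', q ⁻¹ᵁ U) X'.functionField))) := by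
  have := nonempty_preimage_of_isDominant φ U
  let : Algebra X.functionField Y.functionField := (functionFieldMap φ).toAlgebra
  have : FiniteDimensional X.functionField Y.functionField := hφ.finite_functionFieldMap
  have : IsGalois X.functionField Y.functionField := hG.1
  have := hφ.isNormal_target.isIntegrallyClosed hU
  have := hφ.isFinite
  refine isGalois_adjoinRoot_map (hf.adjoin_germToFunctionField (hU.preimage φ))
    (functionFieldMap q) ?_
  rw [hf.minpoly_functionField hU, Polynomial.map_map, Polynomial.map_map]
  congr 1
  exact RingHom.ext fun r ↦ functionFieldMap_germToFunctionField q U r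

end BaseChange

/-- In the application this identifies the base-changed polynomial evaluated at x_E with f_x viewed
over E. -/
lemma evalAt_comp {K E : CommRingCat.{u}} {X X' : Scheme.{u}} {x : Spec K ⟶ X} {g : K ⟶ E}
    {x' : Spec E ⟶ X'} {q : X' ⟶ X} (h : x' ≫ q = Spec.map g ≫ x) {U : X.Opens}
    (hx : ⊤ ≤ x ⁻¹ᵁ U) (hx' : ⊤ ≤ x' ⁻¹ᵁ q ⁻¹ᵁ U) :
    q.app U ≫ evalAt x' (q ⁻¹ᵁ U) hx' = evalAt x U hx ≫ g := by
  have hg : (Spec.map g).appTop = (Spec.map g).appLE ⊤ ⊤ (le_preimage_top _ _) :=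
    Scheme.Hom.app_eq_appLE _
  rw [evalAt, evalAt, Category.assoc, ← Scheme.ΓSpecIso_naturality, hg,
    Scheme.Hom.appLE_comp_appLE_assoc, Scheme.Hom.app_eq_appLE, Scheme.Hom.appLE_comp_appLE_assoc]
  simp_rw [h]

end

end ThinSets

end

/-! ### Density of the good points -/

theorem mainTheorem10 {k K : Type u} [Field k] [CharZero k] [Field K] [Algebra k K]
    (hreg : ThinSets.IsRegularExtension (algebraMap k K))
    (hfg : (⊤ : IntermediateField k K).FG)
    (htr : Algebra.Transcendental k K)
    {X Y : Scheme.{u}} (pX : X ⟶ Spec (.of K)) (pY : Y ⟶ Spec (.of K)) (φ : Y ⟶ X)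
    (hφ : φ ≫ pX = pY)
    (hX : ThinSets.IsVariety pX) (hY : ThinSets.IsVariety pY)
    (hXgi : GeometricallyIntegral pX) (hYgi : GeometricallyIntegral pY)
    (G : Type*) [Group G] (hG : ThinSets.IsGaloisCover φ G)
    (S : Set (ThinSets.RatPoint pX))
    (hS : ¬ ThinSets.IsThin
      ((fun x : ThinSets.RatPoint pX ↦ x.baseChange
        (Spec.map (CommRingCat.ofHom (algebraMap K (ThinSets.geometricField k K))))) '' S)) :
    ThinSets.IsZariskiDense
      {x : ThinSets.RatPoint pX | x ∈ S ∧
        ∃ _ : IsIntegral (pullback φ x.hom),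
          ThinSets.IsRegularExtension
            ((ThinSets.groundFieldMap (pullback.snd φ x.hom)).comp (algebraMap k K)) ∧
          ThinSets.IsGaloisWithGroup (ThinSets.groundFieldMap (pullback.snd φ x.hom)) G} := by
  obtain ⟨h, hG⟩ := hG
  subst hφ
  have := h.isIntegral_target
  have := h.isIntegral_source
  have := h.isDominant
  have := h.isFinite
  have := hX.locallyOfFiniteType
  let E := ThinSets.geometricField k K
  have : CharZero K := charZero_of_injective_algebraMap (algebraMap k K).injective
  obtain ⟨U, hU, _, f, b, hf⟩ := h.exists_isSimpleEtale hG.1.1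
  let g : Spec (.of E) ⟶ Spec (.of K) := Spec.map (CommRingCat.ofHom (algebraMap K E))
  let q : pullback pX g ⟶ X := pullback.fst pX g
  let p : pullback pX g ⟶ Spec (.of E) := pullback.snd pX g
  have hpX : IsPullback q p pX g := IsPullback.of_hasPullback pX g
  have hφq : IsPullback (pullback.fst φ q) (pullback.snd φ q) φ q := IsPullback.of_hasPullback φ q
  have : IsIntegral (pullback pX g) := hXgi.geometrically_isIntegral _ _ _ hpX
  have : IsIntegral (pullback φ q) :=
    hYgi.geometrically_isIntegral _ _ _ (hφq.paste_vert hpX)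
  have hnormal : ThinSets.IsNormalScheme (pullback pX g) :=
    h.isNormal_target.of_isPullback hpX
  have : IsAffineHom q := MorphismProperty.of_isPullback hpX.flip inferInstance
  have : Surjective q :=
    MorphismProperty.of_isPullback hpX.flip (ThinSets.surjective_SpecMap_of_field _)
  -- This is needed for normalizations of the base change of X to be finite.
  have : IsLocallyNoetherian (pullback pX g) := LocallyOfFiniteType.isLocallyNoetherian p
  have := ThinSets.nonempty_preimage_of_isDominant q U
  have hirr := Fact.mk (hf.irreducible_map hnormal hφq hU)
  have : CharZero (pullback pX g).functionField :=
    charZero_of_injective_ringHom (ThinSets.groundFieldMap p).injective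
  have := hf.isGalois_adjoinRoot h hG (q := q) hU
  have hthin := ThinSets.isThin_setOf_not_irreducible hnormal p (hU.preimage q)
    (hf.monic.map (q.app U).hom) hf.separable.map
  refine dense_iff_inter_open.mpr fun O hO hOne ↦ ?_
  by_contra hempty
  apply hS
  obtain ⟨z, hzO, hzU⟩ : (O ∩ U).Nonempty :=
    nonempty_preirreducible_inter hO U.isOpen hOne (Set.nonempty_coe_sort.mp ‹_›)
  -- The closed set is proper because X is irreducible, so O meets U, and q is surjective.
  refine ((ThinSets.isThin_pointsOn (p := p) (W := q ⁻¹' (O ∩ U)ᶜ) ?_ ?_).union hthin).mono ?_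
  · exact (hO.inter U.isOpen).isClosed_compl.preimage q.continuous
  · obtain ⟨z, rfl⟩ := q.surjective z
    exact fun hW ↦ (hW ▸ Set.mem_univ z : z ∈ q ⁻¹' (O ∩ U)ᶜ) ⟨hzO, hzU⟩
  rintro _ ⟨x, hxS, rfl⟩
  have hxq : (x.baseChange g).hom ≫ q = g ≫ x.hom := pullback.lift_fst _ _ _
  by_cases hx : Set.range x.hom ⊆ (O ∩ U)ᶜ
  · refine .inl ?_
    rintro _ ⟨y, rfl⟩
    change q ((x.baseChange g).hom y) ∈ (O ∩ U)ᶜ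
    rw [← Scheme.Hom.comp_apply, hxq, Scheme.Hom.comp_apply]
    exact hx ⟨_, rfl⟩
  refine .inr ?_
  obtain ⟨_, ⟨y, rfl⟩, hy⟩ := Set.not_subset.mp hx
  rw [Set.mem_compl_iff, not_not] at hy
  have hxU : ⊤ ≤ x.hom ⁻¹ᵁ U := fun y' _ ↦ by
    obtain rfl : y = y' := Subsingleton.elim (α := PrimeSpectrum K) _ _
    exact hy.2
  have hxU' : ⊤ ≤ (x.baseChange g).hom ⁻¹ᵁ q ⁻¹ᵁ U := by
    rw [← Scheme.Hom.comp_preimage, hxq, Scheme.Hom.comp_preimage]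
    exact fun y _ ↦ hxU (x := g y) trivial
  -- Were the specialization irreducible over E, x would be a good point in O, which O was chosen to
  -- avoid.
  refine ⟨hxU', fun hirr ↦ hempty ⟨x.hom y, hy.1, ?_⟩⟩
  rw [Polynomial.map_map, ← CommRingCat.hom_comp, ThinSets.evalAt_comp hxq hxU,
    CommRingCat.hom_comp, ← Polynomial.map_map] at hirr
  exact Set.mem_biUnion (x := x) ⟨hxS, hf.isGaloisWithGroup_pullback h hG hU hreg x hxU hirr⟩
    ⟨y, rfl⟩
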